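/- **Setting.** Let $\Sigma$ be a signature consisting of a constant $\emptyset$, a binary symbol $\cup$ and any collection of free function symbols, each of a fixed finite arity; let $\mathcal V$ be a denumerable set of variables. A system is a finite conjunction of equations between $\Sigma$-terms. Every term can be read as $a_1\cup\dots\cup a_n$ where no $a_i$ has $\cup$ outermost; the $a_i$ are its summands. **The procedure** $\mathit{general\_aci}(\mathcal E)$ starts with $\mathcal E_s=\emptyset$, $\mathcal E_{ns}=\mathcal E$ and, while $\mathcal E_{ns}\neq\emptyset$, performs an iteration: select an arbitrary equation $e$ of $\mathcal E_{ns}$, remove it, and apply the rule that matches it. A variable is new if it has not been used so far in the computation. 1. $X=X$: nothing more is done. 2. $t=X$, $t$ not a variable: add $X=t$ to $\mathcal E_{ns}$. 3. $X=t$, where $X$ occurs inside a non-variable summand of $t$: fail. 4. $X=t$, where $X$ does not occur in $t$: $\mathcal E_s:=\mathcal E_s[X/t]\wedge(X=t)$, $\mathcal E_{ns}:=\mathcal E_{ns}[X/t]$. 5. $X=t$, where $t\not\equiv X$ is, up to reordering, $t'\cup X\cup\dots\cup X$ (at least one $X$) and $X$ does not occur in $t'$ (the part $t'$ may be missing): add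 $X=t'\cup N$ to $\mathcal E_{ns}$, $N$ a new variable. 6. $f(s_1,\dots,s_m)=g(t_1,\dots,t_n)$ with $f\not\equiv g$ (any two different symbols of $\Sigma$): fail. 7. $f(s_1,\dots,s_n)=f(t_1,\dots,t_n)$ with $f\not\equiv\cup$: add $s_1=t_1,\dots,s_n=t_n$ to $\mathcal E_{ns}$. 8. $l=r$ where both $l$ and $r$ have outermost symbol $\cup$: let $\langle \mathcal E_1,\mathcal E_2,\rho\rangle$ be a result of $\mathit{aci\_step}(l=r)$ (or fail if it fails); $\mathcal E_s:=\mathcal E_s\rho\wedge\mathcal E_1$, $\mathcal E_{ns}:=\mathcal E_{ns}\rho\wedge\mathcal E_2$. **The non-deterministic function** $\mathit{aci\_step}(l=r)$. Discard the summands $\emptyset$. Let $f_1(\bar l_1),\dots,f_{k}(\bar l_{k})$ be the non-variable summands of $l$ and $g_1(\bar r_1),\dots,g_{h}(\bar r_{h})$ those of $r$. Take a matrix of new, pairwise distinct variables $A_{i,j}$ whose columns are indexed by the $f_j(\bar l_j)$ and by the variables among the summands of $l$, and whose rows are indexed by the $g_i(\bar r_i)$ and by the variables among the summands of $r$; in the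 block of the variables common to both sides only the diagonal is used. * *Propagation.* For each $A_{i,j}$ that lies in the row of some $g_i(\bar r_i)$ or in the column of some $f_j(\bar l_j)$, choose $\lambda(A_{i,j})$ to be $\emptyset$ or the term of its row or column (either of the two terms, if both are non-variable terms). The other $A_{i,j}$ are left unchanged. For each column of a term $f_j(\bar l_j)$ and each row of a term $g_i(\bar r_i)$, the set of the non-$\emptyset$ values of $\lambda$ in it must be non-empty and its members must have the same outermost symbol as that term; otherwise fail. Let $\mathcal E_2'$ consist of the equations $\bar s=\bar s'$ (argument by argument) for each such term $f(\bar s)$ and each member $f(\bar s')$ of its set; trivial equations $s=s$ may be dropped from it or kept. * *Equations for the variables.* For each variable $X$ among the summands of $l$ or $r$ let $u_X$ be the union, without $\emptyset$ and repetitions, of the values $\lambda(A_{i,j})$ over the row and the column of $X$ (those that exist); the empty union is $\emptyset$. $\mathcal E_1$ consists of the equations $X=u_X$. * *Variables removal.* Write $X\Rightarrow Y$ if $Y$ occurs in $u_X$. If some of these $X$ is related to itself by the transitive closure of $\Rightarrow$, fail. Otherwise $\rho$ is the composition of all the $[X/u_X]$, in an order such that all these variables are removed. * The result is $\langle\mathcal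 E_1,\mathcal E_2'\rho,\rho\rangle$. **Theorem (termination).** For every system of equations $\mathcal E$, all the non-deterministic branches of the computation of $\mathit{general\_aci}(\mathcal E)$ terminate: there is no infinite sequence of iterations that starts with $\mathcal E_s=\emptyset$, $\mathcal E_{ns}=\mathcal E$, whatever equations are selected and whatever choices are made. -/

import Mathlib

namespace GeneralACI

/-- Terms over the signature that consists of the constant `∅`, the binary symbol `∪` and the free
function symbols `F` (the symbol `f` has arity `ar f`), with variables in `V`. -/
inductive Term {F : Type*} (ar : F → ℕ) (V : Type*) where
  | var (x : V) : Term ar V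
  | empty : Term ar V
  | union (s t : Term ar V) : Term ar V
  | app (f : F) (args : Fin (ar f) → Term ar V) : Term ar V

/-- The function symbols of the signature. -/
inductive Sym (F : Type*) where
  | empty : Sym F
  | union : Sym F
  | free (f : F) : Sym F

variable {F : Type*} {ar : F → ℕ} {V : Type*}

namespace Term

/-- The variables that occur in a term. -/
def vars : Term ar V → Set V
  | var x => {x}
  | empty => ∅
  | union s t => s.vars ∪ t.vars
  | app _ args => ⋃ i, (args i).vars

/-- Application of a substitution to a term. -/
def subst (σ : V → Term ar V) : Term ar V → Term ar V
  | var x => σ x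
  | empty => empty
  | union s t => union (s.subst σ) (t.subst σ)
  | app f args => app f (fun i => (args i).subst σ)

/-- The outermost function symbol; `none` for a variable. -/
def head : Term ar V → Option (Sym F)
  | var _ => none
  | empty => some Sym.empty
  | union _ _ => some Sym.union
  | app f _ => some (Sym.free f)

/-- The list of the arguments of the outermost function symbol. -/
def args : Term ar V → List (Term ar V)
  | var _ => []
  | empty => []
  | union s t => [s, t]
  | app _ a => List.ofFn a

/-- A term read, by associativity, as `a₁ ∪ ⋯ ∪ aₙ` where no `aᵢ` has `∪` outermost:
the list of its summands `aᵢ`. -/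
def summands : Term ar V → List (Term ar V)
  | union s t => s.summands ++ t.summands
  | t => [t]

/-- The summands of a set term of the form `f(s̄)` with `f` free. A summand `∅` is dropped,
as `X ∪ ∅ ≈ X`. -/
def indivs (t : Term ar V) : List (Term ar V) :=
  t.summands.filter fun s => match s with
    | app _ _ => true
    | _ => false

open scoped Classical in
/-- The variables among the summands of a set term (without repetitions). -/
noncomputable def topVars (t : Term ar V) : Finset V :=
  (t.summands.filterMap fun s => match s with
    | var x => some x
    | _ => none).toFinset

/-- `X` occurs inside a summand `f(s̄)` of `t`, so that `X ∈ vars(s̄)`. -/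
def OccursInside (X : V) (t : Term ar V) : Prop :=
  ∃ s ∈ t.summands, s.head ≠ none ∧ X ∈ s.vars

/-- `t` is, up to reordering, the union of the finite set of terms `S`; the empty union is `∅`. -/
def IsUnionOf (t : Term ar V) (S : Finset (Term ar V)) : Prop :=
  (S = ∅ ∧ t = empty) ∨ (S.Nonempty ∧ (t.summands : Multiset (Term ar V)) = S.val)

end Term

open Term

open scoped Classical in
/-- The substitution `[X/t]`. -/
noncomputable def single (X : V) (t : Term ar V) : V → Term ar V :=
  fun Y => if Y = X then t else var Y

/-- The composition that applies `σ` first and `τ` second. -/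
def comp (σ τ : V → Term ar V) : V → Term ar V :=
  fun X => (σ X).subst τ

/-- An equation `l = r`, as the pair `(l, r)`. -/
abbrev Equation {F : Type*} (ar : F → ℕ) (V : Type*) := Term ar V × Term ar V

/-- A system of equations: a finite conjunction. -/
abbrev System {F : Type*} (ar : F → ℕ) (V : Type*) := Multiset (Equation ar V)

/-- The variables that occur in a system. -/
def System.vars (E : System ar V) : Set V :=
  {x | ∃ e ∈ E, x ∈ e.1.vars ∪ e.2.vars}

/-- Application of a substitution to all the equations of a system. -/
def System.applySubst (E : System ar V) (σ : V → Term ar V) : System ar V :=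
  Multiset.map (fun e => (e.1.subst σ, e.2.subst σ)) E

/-- For `s = f(s₁,…,sₙ)` and `t = f(t₁,…,tₙ)`, the system `s₁ = t₁ ∧ ⋯ ∧ sₙ = tₙ`. -/
def argEqs (s t : Term ar V) : System ar V :=
  ↑(s.args.zip t.args)

/-! ### The function for equations between two set terms

The equation is `l = r`. The columns of the matrix are indexed by the summands `f_j(l̄_j)` of `l`
and the variables among the summands of `l`; the rows likewise by those of `r`. -/

/-- Indices of rows or columns. -/
abbrev Index (t : Term ar V) := Fin t.indivs.length ⊕ {x // x ∈ t.topVars}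

/-- The index `i` is that of the variable `X`. -/
def Index.IsVar {t : Term ar V} (X : V) : Index t → Prop
  | .inl _ => False
  | .inr x => x.1 = X

/-- The cells of the matrix that are in use: all of them, except that in the block of the variables
common to both sides only the diagonal is used. -/
def Live {l r : Term ar V} : Index r → Index l → Prop
  | .inr x, .inr y => x.1 ∈ l.topVars → y.1 ∈ r.topVars → x.1 = y.1
  | _, _ => True

/-- The non-deterministic choices for the equation `l = r`, where `used` is the set of the
variables used so far. -/
structure Guess (used : Set V) (l r : Term ar V) where
  /-- The new variables `A_{i,j}` of the solution of the elementary problem. -/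
  A : Index r → Index l → V
  fresh : ∀ i j, Live i j → A i j ∉ used
  distinct : ∀ i j i' j', Live i j → Live i' j' → A i j = A i' j' → i = i' ∧ j = j'
  /-- The values `λ(A_{i,j})`. -/
  lam : Index r → Index l → Term ar V
  /-- `A_{i,j}` occurs in the equations of `g_i(r̄_i)` and of `f_j(l̄_j)`; it is bound to `∅` or to
  the left-hand side of whichever of the two equations is considered first. -/
  lam_indiv_indiv : ∀ i j, lam (.inl i) (.inl j) = empty ∨
    lam (.inl i) (.inl j) = r.indivs.get i ∨ lam (.inl i) (.inl j) = l.indivs.get j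
  lam_indiv_var : ∀ i y, lam (.inl i) (.inr y) = empty ∨ lam (.inl i) (.inr y) = r.indivs.get i
  lam_var_indiv : ∀ x j, lam (.inr x) (.inl j) = empty ∨ lam (.inr x) (.inl j) = l.indivs.get j
  /-- Such an `A_{i,j}` occurs in no equation of an individual and stays a variable. -/
  lam_var_var : ∀ x y, lam (.inr x) (.inr y) = var (A (.inr x) (.inr y))

namespace Guess

variable {used : Set V} {l r : Term ar V} (G : Guess used l r)

/-- The new variables introduced by the guess. -/
def newVars : Set V := {v | ∃ i j, Live i j ∧ v = G.A i j}

open scoped Classical in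
/-- The variables `L_j` and `R_i`. -/
noncomputable def dom (_ : Guess used l r) : Finset V := l.topVars ∪ r.topVars

open scoped Classical in
/-- The right-hand side of the equation `f_j(l̄_j) = ⋃_i A_{i,j}` under `λ`: its summands, without
`∅` and repetitions. -/
noncomputable def colSummands (j : Fin l.indivs.length) : Finset (Term ar V) :=
  (Finset.univ.image fun i => G.lam i (.inl j)).erase empty

open scoped Classical in
/-- The right-hand side of the equation `g_i(r̄_i) = ⋃_j A_{i,j}` under `λ`. -/
noncomputable def rowSummands (i : Fin r.indivs.length) : Finset (Term ar V) :=
  (Finset.univ.image fun j => G.lam (.inl i) j).erase empty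

open scoped Classical in
/-- The right-hand side of the equation `X = ⋃ A_{i,j}` of a variable `X` under `λ`: the union is
over the cells of the column of `X` and of the row of `X` (both exist if `X` is common to both
sides, and only one of them otherwise). -/
noncomputable def varSummands (X : V) : Finset (Term ar V) :=
  ((Finset.univ.filter fun c : Index r × Index l =>
      Live c.1 c.2 ∧ (Index.IsVar X c.1 ∨ Index.IsVar X c.2)).image
    fun c => G.lam c.1 c.2).erase empty

/-- Term propagation does not fail: every `f(s̄)` is equated to a non-empty union, and to terms with
the same outermost symbol only. -/
def Propagates : Prop :=
  (∀ j, (G.colSummands j).Nonempty ∧ ∀ u ∈ G.colSummands j, u.head = (l.indivs.get j).head) ∧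
  (∀ i, (G.rowSummands i).Nonempty ∧ ∀ u ∈ G.rowSummands i, u.head = (r.indivs.get i).head)

/-- All the equations `s̄ = s̄'` obtained from the equations `f(s̄) = f(s̄') ∪ ⋯`. -/
noncomputable def confEqs : System ar V :=
  ∑ j, ∑ u ∈ G.colSummands j, argEqs (l.indivs.get j) u +
  ∑ i, ∑ u ∈ G.rowSummands i, argEqs (r.indivs.get i) u

/-- `u` gives the right-hand sides of the equations for the variables. -/
def IsRhs (u : V → Term ar V) : Prop :=
  ∀ X ∈ G.dom, (u X).IsUnionOf (G.varSummands X)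

/-- The system `𝓔₁`. -/
noncomputable def varEqs (u : V → Term ar V) : System ar V :=
  G.dom.val.map fun X => (var X, u X)

/-- The relation `X ⇒ Y`: the variable `Y` occurs in `X ρ_X = u X`. -/
def DependsOn (u : V → Term ar V) (X Y : V) : Prop :=
  X ∈ G.dom ∧ Y ∈ (u X).vars

/-- The test of the variables removal step. -/
def NoCycle (u : V → Term ar V) : Prop :=
  ∀ X ∈ G.dom, ¬ Relation.TransGen (G.DependsOn u) X X

/-- `ρ` is the composition of the substitutions `ρ_X = [X/u X]`, for the variables `X` of `dom`,
in an order in which all of these variables are removed: no variable is reintroduced by a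
substitution that is applied after its own. -/
def IsRemoval (u : V → Term ar V) (ρ : V → Term ar V) : Prop :=
  ∃ L : List V, (L : Multiset V) = G.dom.val ∧ L.Pairwise (fun X Y => ¬ G.DependsOn u Y X) ∧
    ρ = L.foldl (fun σ X => comp σ (single X (u X))) var

end Guess

/-- `⟨E₁, E₂, ρ⟩` is a result of the function for `l = r`, with the new variables `new`. Equations
`s = s` of the term propagation step may be dropped from `E₂` or not. -/
def AciStep (used : Set V) (l r : Term ar V)
    (E₁ E₂ : System ar V) (ρ : V → Term ar V) (new : Set V) : Prop :=
  ∃ (G : Guess used l r) (u : V → Term ar V) (E T : System ar V),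
    G.Propagates ∧ G.IsRhs u ∧ G.NoCycle u ∧ G.IsRemoval u ρ ∧
    G.confEqs = E + T ∧ (∀ e ∈ T, e.1 = e.2) ∧
    E₁ = G.varEqs u ∧ E₂ = System.applySubst E ρ ∧ new = G.newVars

/-- Some guess of the function for `l = r` leads to a failure. -/
def AciFail (used : Set V) (l r : Term ar V) : Prop :=
  ∃ (G : Guess used l r) (u : V → Term ar V),
    G.IsRhs u ∧ ¬ (G.Propagates ∧ G.NoCycle u)

/-! ### The main procedure -/

/-- A configuration: `fail`, or the two systems `𝓔_s` and `𝓔_ns`, together with the set of all the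
variables used so far in the computation (a new variable is one outside this set). -/
inductive Config {F : Type*} (ar : F → ℕ) (V : Type*) where
  | run (Es Ens : System ar V) (used : Set V) : Config ar V
  | fail : Config ar V

/-- The initial configuration for the system `E`. -/
def Config.init (E : System ar V) : Config ar V := .run 0 E (System.vars E)

/-- One iteration of the main loop. An arbitrary equation `e` of `𝓔_ns = e ::ₘ Ens` is selected
and removed, and a rule is applied to it. -/
inductive Iteration : Config ar V → Config ar V → Prop where
  | trivial {Es Ens used} (X : V) :
      Iteration (.run Es ((var X, var X) ::ₘ Ens) used) (.run Es Ens used)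
  | orient {Es Ens used} (t : Term ar V) (X : V) (ht : t.head ≠ none) :
      Iteration (.run Es ((t, var X) ::ₘ Ens) used) (.run Es ((var X, t) ::ₘ Ens) used)
  | occursCheck {Es Ens used} (X : V) (t : Term ar V) (h : t.OccursInside X) :
      Iteration (.run Es ((var X, t) ::ₘ Ens) used) .fail
  | eliminate {Es Ens used} (X : V) (t : Term ar V) (h : X ∉ t.vars) :
      Iteration (.run Es ((var X, t) ::ₘ Ens) used)
        (.run ((var X, t) ::ₘ System.applySubst Es (single X t)) (System.applySubst Ens (single X t)) used)
  /- `t` is, up to reordering, `t' ∪ X ∪ ⋯ ∪ X`, and `w` is `t' ∪ N`. -/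
  | absorb {Es Ens used} (X N : V) (t w : Term ar V) (t' : Multiset (Term ar V)) (k : ℕ)
      (hX : t ≠ var X) (hk : 1 ≤ k)
      (ht : (t.summands : Multiset (Term ar V)) = t' + Multiset.replicate k (var X))
      (ht' : ∀ s ∈ t', X ∉ s.vars) (hN : N ∉ used)
      (hw : (w.summands : Multiset (Term ar V)) = t' + {var N}) :
      Iteration (.run Es ((var X, t) ::ₘ Ens) used)
        (.run Es ((var X, w) ::ₘ Ens) (insert N used))
  | clash {Es Ens used} (s t : Term ar V) (f g : Sym F)
      (hs : s.head = some f) (ht : t.head = some g) (h : f ≠ g) :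
      Iteration (.run Es ((s, t) ::ₘ Ens) used) .fail
  | decompose {Es Ens used} (s t : Term ar V) (f : Sym F)
      (hs : s.head = some f) (ht : t.head = some f) (h : f ≠ Sym.union) :
      Iteration (.run Es ((s, t) ::ₘ Ens) used) (.run Es (Ens + argEqs s t) used)
  | setStep {Es Ens used} (s₁ s₂ t₁ t₂ : Term ar V) (E₁ E₂ : System ar V)
      (ρ : V → Term ar V) (new : Set V)
      (h : AciStep used (union s₁ s₂) (union t₁ t₂) E₁ E₂ ρ new) :
      Iteration (.run Es ((union s₁ s₂, union t₁ t₂) ::ₘ Ens) used)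
        (.run (System.applySubst Es ρ + E₁) (System.applySubst Ens ρ + E₂) (used ∪ new))
  | setFail {Es Ens used} (s₁ s₂ t₁ t₂ : Term ar V)
      (h : AciFail used (union s₁ s₂) (union t₁ t₂)) :
      Iteration (.run Es ((union s₁ s₂, union t₁ t₂) ::ₘ Ens) used) .fail

end GeneralACI

/-! Suppose a computation never stops. Its whole sequence of substitutions is then fixed, so a
measure may look into the future: the `rank` of a term at stage `n` is the supremum of the depths
(nesting of free symbols; `∪` costs nothing) of its instances under the substitutions still to come.

This supremum is finite (`Run.hasRank`). The only terms with a free outermost symbol after an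
iteration are instances of those present before it (`Run.apps_subset_tracked`), so at every stage
they lie in an image of the finite initial set. A term is at most as deep as the number of distinct
such terms in it (`depth_le_ncard_apps`). Ranks do not change when the current substitution is
applied (`rank_succ`), so an equation that is not selected keeps its rank, the maximum of the ranks
of its sides.

A decomposition or a set step replaces the selected equation with instances of equations between
arguments of its subterms, which have smaller rank; a trivial equation or an elimination leaves
nothing behind. In these cases the multiset of ranks decreases in the Dershowitz–Manna order.
Orientation and absorption put one equation in place of another, do not raise the rank, and lower
`Equation.shape`. The lexicographic combination of the multiset of ranks and the sum of the shapes
therefore descends forever, which is impossible.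

The delicate point is absorption, `X = t' ∪ X` becoming `X = t' ∪ N`: nothing bounds the future of
the new `N` at once. But `N` occurs in this equation only, as a single summand of one side. This
persists until the equation is used up, and then the value of `N` is dominated by the other side
(`Guess.removal_dominated`, `Run.depth_loneVar_le`). -/

namespace GeneralACI

open Term

variable {F : Type*} {ar : F → ℕ} {V : Type*}

/-! ### Substitutions, summands and variables -/

namespace Term

theorem subst_var (t : Term ar V) : t.subst var = t := by
  induction t with
  | var x => rfl
  | empty => rfl
  | union s t hs ht => simp [subst, hs, ht]
  | app f a h => simp [subst, h]

theorem subst_comp (σ τ : V → Term ar V) (t : Term ar V) :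
    t.subst (comp σ τ) = (t.subst σ).subst τ := by
  induction t with
  | var x => rfl
  | empty => rfl
  | union s t hs ht => simp [subst, hs, ht]
  | app f a h => simp [subst, h]

theorem subst_congr {σ τ : V → Term ar V} {t : Term ar V} (h : ∀ x ∈ t.vars, σ x = τ x) :
    t.subst σ = t.subst τ := by
  induction t with
  | var x => exact h x rfl
  | empty => rfl
  | union s t hs ht =>
    simp only [subst]
    rw [hs fun x hx => h x (Or.inl hx), ht fun x hx => h x (Or.inr hx)]
  | app f a ih =>
    simp only [subst]
    congr 1
    funext i
    exact ih i fun x hx => h x (Set.mem_iUnion.2 ⟨i, hx⟩)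

theorem subst_eq_self {σ : V → Term ar V} {t : Term ar V} (h : ∀ x ∈ t.vars, σ x = var x) :
    t.subst σ = t :=
  (subst_congr h).trans t.subst_var

theorem mem_vars_subst {σ : V → Term ar V} {t : Term ar V} {y : V} :
    y ∈ (t.subst σ).vars ↔ ∃ x ∈ t.vars, y ∈ (σ x).vars := by
  induction t with
  | var x => simp [subst, vars]
  | empty => simp [subst, vars]
  | union s t hs ht => simp [subst, vars, hs, ht, or_and_right, exists_or]
  | app f a ih =>
    simp only [subst, vars, Set.mem_iUnion, ih]
    constructor
    · rintro ⟨i, x, hx, hy⟩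
      exact ⟨x, ⟨i, hx⟩, hy⟩
    · rintro ⟨x, ⟨i, hx⟩, hy⟩
      exact ⟨i, x, hx, hy⟩

theorem mem_vars_iff_summands {t : Term ar V} {y : V} :
    y ∈ t.vars ↔ ∃ s ∈ t.summands, y ∈ s.vars := by
  induction t with
  | union s t hs ht => simp [summands, vars, hs, ht, or_and_right, exists_or]
  | _ => simp [summands]

theorem mem_vars_of_var_mem_summands {t : Term ar V} {y : V} (h : var y ∈ t.summands) :
    y ∈ t.vars :=
  mem_vars_iff_summands.2 ⟨_, h, rfl⟩

theorem summands_subst (σ : V → Term ar V) (t : Term ar V) :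
    (t.subst σ).summands = t.summands.flatMap fun s => (s.subst σ).summands := by
  induction t with
  | union s t hs ht => simp [summands, subst, hs, ht]
  | _ => simp [summands]

theorem mem_topVars {t : Term ar V} {x : V} : x ∈ t.topVars ↔ var x ∈ t.summands := by
  simp only [topVars, List.mem_toFinset, List.mem_filterMap]
  constructor
  · rintro ⟨a, ha, h⟩
    cases a <;> simp at h
    exact h ▸ ha
  · exact fun h => ⟨_, h, rfl⟩

theorem mem_vars_of_mem_topVars {t : Term ar V} {x : V} (h : x ∈ t.topVars) : x ∈ t.vars :=
  mem_vars_of_var_mem_summands (mem_topVars.1 h)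

theorem mem_summands_of_mem_indivs {s t : Term ar V} (h : s ∈ t.indivs) : s ∈ t.summands :=
  (List.mem_filter.1 h).1

theorem IsUnionOf.mem_summands {t s : Term ar V} {S : Finset (Term ar V)} (h : t.IsUnionOf S)
    (hs : s ∈ S) : s ∈ t.summands := by
  rcases h with ⟨rfl, -⟩ | ⟨-, h⟩
  · simp at hs
  · rw [← Multiset.mem_coe, h]
    exact hs

theorem IsUnionOf.eq_empty_or_mem {t s : Term ar V} {S : Finset (Term ar V)} (h : t.IsUnionOf S)
    (hs : s ∈ t.summands) : s = empty ∨ s ∈ S := by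
  rcases h with ⟨-, rfl⟩ | ⟨-, h⟩
  · exact Or.inl (by simpa [summands] using hs)
  · rw [← Multiset.mem_coe, h] at hs
    exact Or.inr hs

/-! ### Free subterms and nesting depth -/

/-- The terms with a free outermost symbol that occur in a term. -/
def apps : Term ar V → Set (Term ar V)
  | var _ => ∅
  | empty => ∅
  | union s t => s.apps ∪ t.apps
  | app f a => insert (app f a) (⋃ i, (a i).apps)

/-- The nesting depth of the free symbols. -/
def depth : Term ar V → ℕ
  | var _ => 0
  | empty => 0
  | union s t => max s.depth t.depth
  | app _ a => (Finset.univ.sup fun i => (a i).depth) + 1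

theorem depth_lt_app (f : F) (a : Fin (ar f) → Term ar V) (i : Fin (ar f)) :
    (a i).depth < (app f a).depth :=
  Nat.lt_succ_of_le (Finset.le_sup (f := fun i => (a i).depth) (Finset.mem_univ i))

theorem finite_apps (t : Term ar V) : t.apps.Finite := by
  induction t with
  | var x => exact Set.finite_empty
  | empty => exact Set.finite_empty
  | union s t hs ht => exact hs.union ht
  | app f a ih => exact (Set.finite_iUnion ih).insert _

theorem depth_le_of_mem_apps {s t : Term ar V} (h : s ∈ t.apps) : s.depth ≤ t.depth := by
  induction t with
  | var x => exact h.elim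
  | empty => exact h.elim
  | union a b ha hb =>
    rcases h with h | h
    · exact (ha h).trans (le_max_left _ _)
    · exact (hb h).trans (le_max_right _ _)
  | app f a ih =>
    rcases h with rfl | h
    · rfl
    · obtain ⟨i, hi⟩ := Set.mem_iUnion.1 h
      exact (ih i hi).trans (depth_lt_app f a i).le

/-- Each free symbol on a deepest path contributes a new element: `app f a` is deeper than
everything inside its arguments, hence is not among their free subterms. Counting without repetition
is essential, because substitutions duplicate subterms freely. -/
theorem depth_le_ncard_apps (t : Term ar V) : t.depth ≤ t.apps.ncard := by
  induction t with
  | var x => exact Nat.zero_le _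
  | empty => exact Nat.zero_le _
  | union s t hs ht =>
    exact max_le
      (hs.trans (Set.ncard_le_ncard Set.subset_union_left (finite_apps (union s t))))
      (ht.trans (Set.ncard_le_ncard Set.subset_union_right (finite_apps (union s t))))
  | app f a ih =>
    have hfin : (⋃ i, (a i).apps).Finite := Set.finite_iUnion fun i => finite_apps (a i)
    have hnot : app f a ∉ ⋃ i, (a i).apps := by
      intro h
      obtain ⟨i, hi⟩ := Set.mem_iUnion.1 h
      exact absurd (depth_le_of_mem_apps hi) (not_le.2 (depth_lt_app f a i))
    rw [apps, Set.ncard_insert_of_notMem hnot hfin]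
    refine Nat.succ_le_succ (Finset.sup_le fun i _ => (ih i).trans ?_)
    exact Set.ncard_le_ncard (Set.subset_iUnion (fun i => (a i).apps) i) hfin

theorem mem_apps_subst {σ : V → Term ar V} {s t : Term ar V} (h : s ∈ (t.subst σ).apps) :
    (∃ p ∈ t.apps, s = p.subst σ) ∨ ∃ x ∈ t.vars, s ∈ (σ x).apps := by
  induction t with
  | var x => exact Or.inr ⟨x, rfl, h⟩
  | empty => exact h.elim
  | union a b ha hb =>
    rcases h with h | h
    · exact (ha h).imp (fun ⟨p, hp, e⟩ => ⟨p, Or.inl hp, e⟩) fun ⟨x, hx, e⟩ => ⟨x, Or.inl hx, e⟩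
    · exact (hb h).imp (fun ⟨p, hp, e⟩ => ⟨p, Or.inr hp, e⟩) fun ⟨x, hx, e⟩ => ⟨x, Or.inr hx, e⟩
  | app f a ih =>
    rcases h with rfl | h
    · exact Or.inl ⟨_, Or.inl rfl, rfl⟩
    · obtain ⟨i, hi⟩ := Set.mem_iUnion.1 h
      exact (ih i hi).imp
        (fun ⟨p, hp, e⟩ => ⟨p, Or.inr (Set.mem_iUnion.2 ⟨i, hp⟩), e⟩)
        fun ⟨x, hx, e⟩ => ⟨x, Set.mem_iUnion.2 ⟨i, hx⟩, e⟩

theorem mem_apps_iff_summands {s t : Term ar V} :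
    s ∈ t.apps ↔ ∃ v ∈ t.summands, s ∈ v.apps := by
  induction t with
  | union a b ha hb => simp [summands, apps, ha, hb, or_and_right, exists_or]
  | _ => simp [summands]

theorem vars_subset_of_mem_apps {s t : Term ar V} (h : s ∈ t.apps) : s.vars ⊆ t.vars := by
  induction t with
  | var x => exact h.elim
  | empty => exact h.elim
  | union a b ha hb =>
    rcases h with h | h
    · exact (ha h).trans Set.subset_union_left
    · exact (hb h).trans Set.subset_union_right
  | app f a ih =>
    rcases h with rfl | h
    · rfl
    · obtain ⟨i, hi⟩ := Set.mem_iUnion.1 h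
      exact (ih i hi).trans (Set.subset_iUnion (fun i => (a i).vars) i)

theorem apps_subset_of_mem_summands {s t : Term ar V} (h : s ∈ t.summands) : s.apps ⊆ t.apps :=
  fun _ hp => mem_apps_iff_summands.2 ⟨s, h, hp⟩

theorem vars_subset_of_mem_summands {s t : Term ar V} (h : s ∈ t.summands) : s.vars ⊆ t.vars :=
  fun _ hp => mem_vars_iff_summands.2 ⟨s, h, hp⟩

theorem apps_subset_of_mem_args {s t : Term ar V} (h : s ∈ t.args) : s.apps ⊆ t.apps := by
  cases t with
  | var x => simp [args] at h
  | empty => simp [args] at h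
  | union a b =>
    simp only [args, List.mem_cons, List.not_mem_nil, or_false] at h
    rcases h with rfl | rfl
    · exact Set.subset_union_left
    · exact Set.subset_union_right
  | app f a =>
    simp only [args, List.mem_ofFn] at h
    obtain ⟨i, rfl⟩ := h
    exact fun p hp => Or.inr (Set.mem_iUnion.2 ⟨i, hp⟩)

theorem vars_subset_of_mem_args {s t : Term ar V} (h : s ∈ t.args) : s.vars ⊆ t.vars := by
  cases t with
  | var x => simp [args] at h
  | empty => simp [args] at h
  | union a b =>
    simp only [args, List.mem_cons, List.not_mem_nil, or_false] at h
    rcases h with rfl | rfl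
    · exact Set.subset_union_left
    · exact Set.subset_union_right
  | app f a =>
    simp only [args, List.mem_ofFn] at h
    obtain ⟨i, rfl⟩ := h
    exact fun p hp => Set.mem_iUnion.2 ⟨i, hp⟩

/-! ### Comparison of the depths of all instances -/

/-- All the instances of `t` are at most as deep as those of `s`. -/
def Dominated (t s : Term ar V) : Prop :=
  ∀ τ : V → Term ar V, (t.subst τ).depth ≤ (s.subst τ).depth

/-- All the instances of `t` are less deep than those of `s`. -/
def StrictlyDominated (t s : Term ar V) : Prop :=
  ∀ τ : V → Term ar V, (t.subst τ).depth < (s.subst τ).depth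

theorem Dominated.refl (t : Term ar V) : t.Dominated t := fun _ => le_rfl

theorem Dominated.trans {r s t : Term ar V} (h : r.Dominated s) (h' : s.Dominated t) :
    r.Dominated t :=
  fun τ => (h τ).trans (h' τ)

theorem StrictlyDominated.trans_dominated {r s t : Term ar V} (h : r.StrictlyDominated s)
    (h' : s.Dominated t) : r.StrictlyDominated t :=
  fun τ => (h τ).trans_le (h' τ)

theorem Dominated.subst {s t : Term ar V} (h : s.Dominated t) (σ : V → Term ar V) :
    (s.subst σ).Dominated (t.subst σ) := by
  intro τ
  rw [← subst_comp, ← subst_comp]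
  exact h _

theorem dominated_of_mem_summands {s t : Term ar V} (h : s ∈ t.summands) : s.Dominated t := by
  induction t with
  | union a b ha hb =>
    rcases List.mem_append.1 h with h | h
    · exact (ha h).trans fun τ => le_max_left _ _
    · exact (hb h).trans fun τ => le_max_right _ _
  | _ =>
    rw [List.mem_singleton.1 h]
    exact Dominated.refl _

theorem dominated_of_summands {s t : Term ar V} (h : ∀ v ∈ s.summands, v.Dominated t) :
    s.Dominated t := by
  induction s with
  | union a b ha hb =>
    exact fun τ => max_le (ha (fun v hv => h v (List.mem_append_left _ hv)) τ)
      (hb (fun v hv => h v (List.mem_append_right _ hv)) τ)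
  | _ => exact h _ (List.mem_singleton_self _)

theorem empty_dominated (t : Term ar V) : empty.Dominated t := fun _ => Nat.zero_le _

theorem strictlyDominated_of_mem_args {s : Term ar V} {f : F} {a : Fin (ar f) → Term ar V}
    (h : s ∈ (app f a).args) : s.StrictlyDominated (app f a) := by
  simp only [args, List.mem_ofFn] at h
  obtain ⟨i, rfl⟩ := h
  exact fun τ => depth_lt_app f (fun i => (a i).subst τ) i

theorem depth_le_depth_subst (t : Term ar V) (σ : V → Term ar V) :
    t.depth ≤ (t.subst σ).depth := by
  induction t with
  | var x => exact Nat.zero_le _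
  | empty => exact Nat.zero_le _
  | union s t hs ht => exact max_le_max hs ht
  | app f a ih => exact Nat.succ_le_succ (Finset.sup_mono_fun fun i _ => ih i)

theorem exists_app_of_mem_indivs {s t : Term ar V} (h : s ∈ t.indivs) :
    ∃ f a, s = app f a := by
  have := (List.mem_filter.1 h).2
  cases s <;> simp at this
  exact ⟨_, _, rfl⟩

theorem strictlyDominated_of_mem_args_indiv {s p t : Term ar V} (h : s ∈ p.args)
    (hp : p ∈ t.indivs) : s.StrictlyDominated t := by
  obtain ⟨f, a, rfl⟩ := exists_app_of_mem_indivs hp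
  exact (strictlyDominated_of_mem_args h).trans_dominated
    (dominated_of_mem_summands (mem_summands_of_mem_indivs hp))

end Term

/-! ### The substitution of the variables removal step -/

theorem single_self (X : V) (t : Term ar V) : single X t X = t := by simp [single]

theorem single_of_ne {X Y : V} (t : Term ar V) (h : Y ≠ X) : single X t Y = var Y := by
  simp [single, h]

/-- The composite is a fixed point: its value at `X` is its own instance of `u X`. This hides the
order of the removals from all later arguments. -/
theorem foldl_comp_single (u : V → Term ar V) (L : List V)
    (hself : ∀ X ∈ L, X ∉ (u X).vars)
    (hL : L.Pairwise fun X Y => X ∉ (u Y).vars) :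
    (∀ X ∉ L, L.foldl (fun σ X => comp σ (single X (u X))) var X = var X) ∧
    ∀ X ∈ L, L.foldl (fun σ X => comp σ (single X (u X))) var X =
      (u X).subst (L.foldl (fun σ X => comp σ (single X (u X))) var) := by
  induction L using List.reverseRecOn with
  | nil => simp
  | append_singleton L Z ih =>
    rw [List.pairwise_append] at hL
    obtain ⟨ih₁, ih₂⟩ := ih (fun X hX => hself X (List.mem_append_left _ hX)) hL.1
    rw [List.foldl_append, List.foldl_cons, List.foldl_nil]
    set σ := L.foldl (fun σ X => comp σ (single X (u X))) var
    have out : ∀ X, X ∉ L ++ [Z] → comp σ (single Z (u Z)) X = var X := by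
      intro X hX
      simp only [List.mem_append, List.mem_singleton, not_or] at hX
      simp [comp, ih₁ X hX.1, subst, single_of_ne _ hX.2]
    refine ⟨out, fun X hX => ?_⟩
    by_cases hXL : X ∈ L
    · rw [subst_comp, ← ih₂ X hXL]
      rfl
    · have hXZ : X = Z := by simpa [hXL] using hX
      subst hXZ
      have : comp σ (single X (u X)) X = u X := by
        simp [comp, ih₁ X hXL, subst, single_self]
      -- The last variable gets the value `u X`, in which no variable of the list occurs, so the
      -- composite leaves it alone.
      rw [this, subst_eq_self]
      intro Y hY
      refine out Y fun hYL => ?_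
      rcases List.mem_append.1 hYL with h | h
      · exact hL.2.2 Y h X (List.mem_singleton_self _) hY
      · rw [List.mem_singleton.1 h] at hY
        exact hself X hX hY

namespace Guess

variable {used : Set V} {l r : Term ar V} {G : Guess used l r} {u ρ : V → Term ar V}

theorem mem_dom {X : V} : X ∈ G.dom ↔ X ∈ l.topVars ∨ X ∈ r.topVars := by
  simp [dom]

theorem IsRemoval.solved (h : G.IsRemoval u ρ) (hc : G.NoCycle u) :
    (∀ X ∉ G.dom, ρ X = var X) ∧ ∀ X ∈ G.dom, ρ X = (u X).subst ρ := by
  obtain ⟨L, hL, hp, rfl⟩ := h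
  have mem : ∀ X, X ∈ L ↔ X ∈ G.dom := fun X => by
    rw [← Multiset.mem_coe, hL, Finset.mem_val]
  have := foldl_comp_single u L
    (fun X hX hXu => hc X ((mem X).1 hX) (.single ⟨(mem X).1 hX, hXu⟩))
    (hp.imp_of_mem fun {X Y} _ hY hn hXu => hn ⟨(mem Y).1 hY, hXu⟩)
  exact ⟨fun X hX => this.1 X (mt (mem X).1 hX), fun X hX => this.2 X ((mem X).2 hX)⟩

theorem mem_varSummands {X : V} {v : Term ar V} :
    v ∈ G.varSummands X ↔ v ≠ empty ∧ ∃ i j, Live i j ∧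
      (Index.IsVar X i ∨ Index.IsVar X j) ∧ G.lam i j = v := by
  simp [varSummands, and_assoc]

theorem mem_varSummands_cases {X : V} {v : Term ar V} (h : v ∈ G.varSummands X) :
    (v ∈ l.indivs ∧ X ∈ r.topVars) ∨ (v ∈ r.indivs ∧ X ∈ l.topVars) ∨
    ∃ x y, Live (.inr x) (.inr y) ∧ (x.1 = X ∨ y.1 = X) ∧
      v = var (G.A (.inr x) (.inr y)) := by
  obtain ⟨hv, i, j, hlive, hX, rfl⟩ := mem_varSummands.1 h
  match i, j, hX with
  | .inl i, .inl j, hX => exact (hX.elim id id).elim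
  | .inl i, .inr y, hX =>
    have hX : y.1 = X := hX.resolve_left id
    refine Or.inr (Or.inl ⟨?_, hX ▸ y.2⟩)
    rw [(G.lam_indiv_var i y).resolve_left hv]
    exact List.get_mem _ _
  | .inr x, .inl j, hX =>
    have hX : x.1 = X := hX.resolve_right id
    refine Or.inl ⟨?_, hX ▸ x.2⟩
    rw [(G.lam_var_indiv x j).resolve_left hv]
    exact List.get_mem _ _
  | .inr x, .inr y, hX =>
    exact Or.inr (Or.inr ⟨x, y, hlive, hX, G.lam_var_var x y⟩)

theorem var_mem_summands_rhs (hu : G.IsRhs u) {x : {x // x ∈ r.topVars}}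
    {y : {x // x ∈ l.topVars}} (h : Live (.inr x) (.inr y)) {X : V} (hX : x.1 = X ∨ y.1 = X) :
    var (G.A (.inr x) (.inr y)) ∈ (u X).summands := by
  have hd : X ∈ G.dom := by
    rcases hX with rfl | rfl
    · exact mem_dom.2 (Or.inr x.2)
    · exact mem_dom.2 (Or.inl y.2)
  refine (hu X hd).mem_summands (mem_varSummands.2 ⟨by simp, _, _, h, hX, ?_⟩)
  exact G.lam_var_var x y

theorem summands_rhs_cases (hu : G.IsRhs u) {X : V} (hX : X ∈ G.dom) {v : Term ar V}
    (hv : v ∈ (u X).summands) :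
    v = empty ∨ (v ∈ l.indivs ∧ X ∈ r.topVars) ∨ (v ∈ r.indivs ∧ X ∈ l.topVars) ∨
    ∃ x y, Live (.inr x) (.inr y) ∧ (x.1 = X ∨ y.1 = X) ∧
      v = var (G.A (.inr x) (.inr y)) :=
  ((hu X hX).eq_empty_or_mem hv).imp_right mem_varSummands_cases

theorem vars_subset_of_mem_dom {X : V} (h : X ∈ G.dom) : X ∈ l.vars ∪ r.vars :=
  (mem_dom.1 h).imp mem_vars_of_mem_topVars mem_vars_of_mem_topVars

theorem A_notMem_dom (hused : l.vars ∪ r.vars ⊆ used) {i : Index r} {j : Index l}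
    (h : Live i j) : G.A i j ∉ G.dom :=
  fun hd => G.fresh i j h (hused (vars_subset_of_mem_dom hd))

theorem vars_rhs (hu : G.IsRhs u) {X : V} (hX : X ∈ G.dom) :
    (u X).vars ⊆ (l.vars ∪ r.vars) ∪ G.newVars := by
  intro z hz
  obtain ⟨v, hv, hz⟩ := mem_vars_iff_summands.1 hz
  rcases summands_rhs_cases hu hX hv with rfl | ⟨h, -⟩ | ⟨h, -⟩ | ⟨x, y, h, -, rfl⟩
  · exact hz.elim
  · exact Or.inl (Or.inl (vars_subset_of_mem_summands (mem_summands_of_mem_indivs h) hz))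
  · exact Or.inl (Or.inr (vars_subset_of_mem_summands (mem_summands_of_mem_indivs h) hz))
  · exact Or.inr ⟨_, _, h, hz⟩

theorem apps_rhs (hu : G.IsRhs u) {X : V} (hX : X ∈ G.dom) :
    (u X).apps ⊆ l.apps ∪ r.apps := by
  intro z hz
  obtain ⟨v, hv, hz⟩ := mem_apps_iff_summands.1 hz
  rcases summands_rhs_cases hu hX hv with rfl | ⟨h, -⟩ | ⟨h, -⟩ | ⟨x, y, h, -, rfl⟩
  · exact hz.elim
  · exact Or.inl (apps_subset_of_mem_summands (mem_summands_of_mem_indivs h) hz)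
  · exact Or.inr (apps_subset_of_mem_summands (mem_summands_of_mem_indivs h) hz)
  · exact hz.elim

/-- The induction principle given by the test of the variables removal step. -/
theorem NoCycle.induction (hc : G.NoCycle u) {P : V → Prop} (hout : ∀ X ∉ G.dom, P X)
    (hin : ∀ X ∈ G.dom, (∀ Y ∈ (u X).vars, P Y) → P X) (X : V) : P X := by
  let R : G.dom → G.dom → Prop := fun Y X => Relation.TransGen (G.DependsOn u) X.1 Y.1
  have : IsTrans G.dom R := ⟨fun a b c hab hbc => Relation.TransGen.trans hbc hab⟩
  have : Std.Irrefl R := ⟨fun a h => hc a.1 a.2 h⟩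
  have wf : WellFounded R := Finite.wellFounded_of_trans_of_irrefl R
  have key : ∀ X : G.dom, P X.1 := fun X => wf.induction X fun X ih =>
    hin X.1 X.2 fun Y hY => by
      by_cases hYd : Y ∈ G.dom
      · exact ih ⟨Y, hYd⟩ (.single ⟨X.2, hY⟩)
      · exact hout Y hYd
  by_cases hX : X ∈ G.dom
  · exact key ⟨X, hX⟩
  · exact hout X hX

theorem vars_removal (hu : G.IsRhs u) (hc : G.NoCycle u) (hρ : G.IsRemoval u ρ) (X : V) :
    ∀ z ∈ (ρ X).vars, z = X ∨ z ∈ (l.vars ∪ r.vars) ∪ G.newVars := by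
  obtain ⟨h₁, h₂⟩ := hρ.solved hc
  refine hc.induction (P := fun X => ∀ z ∈ (ρ X).vars, z = X ∨ z ∈ (l.vars ∪ r.vars) ∪ G.newVars)
    (fun X hX z hz => ?_) (fun X hX ih z hz => ?_) X
  · rw [h₁ X hX] at hz
    exact Or.inl hz
  · rw [h₂ X hX] at hz
    obtain ⟨y, hy, hz⟩ := mem_vars_subst.1 hz
    rcases ih y hy z hz with rfl | h
    · exact Or.inr (vars_rhs hu hX hy)
    · exact Or.inr h

/-- Free subterms of `u X` come from `l` and `r`; those of `ρ X = (u X)ρ` are `ρ`-instances of them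
or sit in some `ρ Y` with `Y` in `u X`, which the acyclicity induction covers. -/
theorem apps_removal (hu : G.IsRhs u) (hc : G.NoCycle u) (hρ : G.IsRemoval u ρ) (X : V) :
    (ρ X).apps ⊆ Term.subst ρ '' (l.apps ∪ r.apps) := by
  obtain ⟨h₁, h₂⟩ := hρ.solved hc
  refine hc.induction (P := fun X => (ρ X).apps ⊆ Term.subst ρ '' (l.apps ∪ r.apps))
    (fun X hX z hz => ?_) (fun X hX ih z hz => ?_) X
  · rw [h₁ X hX] at hz
    exact hz.elim
  · rw [h₂ X hX] at hz
    rcases mem_apps_subst hz with ⟨p, hp, rfl⟩ | ⟨y, hy, hz⟩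
    · exact ⟨p, apps_rhs hu hX hp, rfl⟩
    · exact ih y hy hz

/-- If `X` is a summand of `r` only, its right-hand side consists of individuals of `l` and of cell
variables `A`, up to `∅`. Each such `A` also belongs to the right-hand side of the variable of `l`
in its column, and `ρ` fixes `A`; so everything in `ρ X` is dominated by the instance of `l`. The
other case is symmetric. -/
theorem removal_dominated (hused : l.vars ∪ r.vars ⊆ used) (hu : G.IsRhs u) (hc : G.NoCycle u)
    (hρ : G.IsRemoval u ρ) {X : V} (hX : X ∈ G.dom) :
    (X ∉ l.topVars → (ρ X).Dominated (l.subst ρ)) ∧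
    (X ∉ r.topVars → (ρ X).Dominated (r.subst ρ)) := by
  obtain ⟨h₁, h₂⟩ := hρ.solved hc
  have hA : ∀ x y, Live (.inr x) (.inr y) → ∀ X ∈ G.dom, (x.1 = X ∨ y.1 = X) →
      (var (G.A (.inr x) (.inr y))).Dominated (ρ X) := by
    intro x y h X hX hxy
    have := (dominated_of_mem_summands (var_mem_summands_rhs (G := G) hu h hxy)).subst ρ
    rw [← h₂ X hX] at this
    simpa only [Term.subst, h₁ _ (A_notMem_dom hused h)] using this
  have hρ_top : ∀ t : Term ar V, ∀ Y ∈ t.topVars, (ρ Y).Dominated (t.subst ρ) := fun t Y hY =>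
    (dominated_of_mem_summands (mem_topVars.1 hY)).subst ρ
  have hind : ∀ t : Term ar V, ∀ v ∈ t.indivs, (v.subst ρ).Dominated (t.subst ρ) := fun t v hv =>
    (dominated_of_mem_summands (mem_summands_of_mem_indivs hv)).subst ρ
  rw [h₂ X hX]
  have reduce : ∀ t : Term ar V, (∀ v ∈ (u X).summands, (v.subst ρ).Dominated t) →
      ((u X).subst ρ).Dominated t := by
    intro t h
    refine dominated_of_summands fun v hv => ?_
    rw [summands_subst, List.mem_flatMap] at hv
    obtain ⟨w, hw, hv⟩ := hv
    exact (dominated_of_mem_summands hv).trans (h w hw)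
  constructor <;> intro hn <;> refine reduce _ fun v hv => ?_ <;>
    rcases summands_rhs_cases hu hX hv with rfl | ⟨h, h'⟩ | ⟨h, h'⟩ | ⟨x, y, h, hxy, rfl⟩
  · exact empty_dominated _
  · exact hind l v h
  · exact absurd h' hn
  · simp only [Term.subst, h₁ _ (A_notMem_dom hused h)]
    exact (hA x y h y.1 (mem_dom.2 (Or.inl y.2)) (Or.inr rfl)).trans (hρ_top l y.1 y.2)
  · exact empty_dominated _
  · exact absurd h' hn
  · exact hind r v h
  · simp only [Term.subst, h₁ _ (A_notMem_dom hused h)]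
    exact (hA x y h x.1 (mem_dom.2 (Or.inr x.2)) (Or.inl rfl)).trans (hρ_top r x.1 x.2)

theorem mem_confEqs {e : Equation ar V} (h : e ∈ G.confEqs) :
    ∃ p q, (p ∈ l.indivs ∨ p ∈ r.indivs) ∧ (q ∈ l.indivs ∨ q ∈ r.indivs) ∧
      e.1 ∈ p.args ∧ e.2 ∈ q.args := by
  have args : ∀ p q : Term ar V, e ∈ argEqs p q → e.1 ∈ p.args ∧ e.2 ∈ q.args := fun p q h =>
    List.of_mem_zip (a := e.1) (b := e.2) h
  have lam : ∀ i j, (∀ x y, i = Sum.inr x → j = Sum.inr y → False) → G.lam i j ≠ empty →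
      G.lam i j ∈ l.indivs ∨ G.lam i j ∈ r.indivs := by
    intro i j hij hne
    match i, j, hij with
    | .inl i, .inl j, _ =>
      rcases (G.lam_indiv_indiv i j).resolve_left hne with h | h <;> rw [h]
      · exact Or.inr (List.get_mem _ _)
      · exact Or.inl (List.get_mem _ _)
    | .inl i, .inr y, _ =>
      rw [(G.lam_indiv_var i y).resolve_left hne]
      exact Or.inr (List.get_mem _ _)
    | .inr x, .inl j, _ =>
      rw [(G.lam_var_indiv x j).resolve_left hne]
      exact Or.inl (List.get_mem _ _)
    | .inr x, .inr y, hij => exact (hij x y rfl rfl).elim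
  rw [confEqs, Multiset.mem_add] at h
  rcases h with h | h
  · obtain ⟨j, -, h⟩ := Multiset.mem_sum.1 h
    obtain ⟨q, hq, h⟩ := Multiset.mem_sum.1 h
    simp only [colSummands, Finset.mem_erase, Finset.mem_image, Finset.mem_univ, true_and] at hq
    obtain ⟨hne, i, rfl⟩ := hq
    exact ⟨_, _, Or.inl (List.get_mem _ _), lam _ _ (by simp) hne, args _ _ h⟩
  · obtain ⟨i, -, h⟩ := Multiset.mem_sum.1 h
    obtain ⟨q, hq, h⟩ := Multiset.mem_sum.1 h
    simp only [rowSummands, Finset.mem_erase, Finset.mem_image, Finset.mem_univ, true_and] at hq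
    obtain ⟨hne, j, rfl⟩ := hq
    exact ⟨_, _, Or.inr (List.get_mem _ _), lam _ _ (by simp) hne, args _ _ h⟩

end Guess

/-! ### One iteration -/

namespace Equation

/-- The variables that occur in an equation. -/
def vars (e : Equation ar V) : Set V := e.1.vars ∪ e.2.vars

/-- The terms with a free outermost symbol that occur in an equation. -/
def apps (e : Equation ar V) : Set (Term ar V) := e.1.apps ∪ e.2.apps

open scoped Classical in
/-- The number of rearrangements that can be applied in a row to an equation. -/
noncomputable def shape : Equation ar V → ℕ
  | (var X, t) => if X ∈ t.vars then 1 else 0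
  | (_, var _) => 2
  | _ => 0

theorem shape_orient {t : Term ar V} {X : V} (ht : t.head ≠ none) :
    shape ((var X, t) : Equation ar V) < shape ((t, var X) : Equation ar V) := by
  have : shape ((t, var X) : Equation ar V) = 2 := by
    cases t with
    | var y => exact (ht rfl).elim
    | _ => rfl
  rw [this, shape]
  split_ifs <;> norm_num

theorem shape_absorb {t w : Term ar V} {X : V} (ht : X ∈ t.vars) (hw : X ∉ w.vars) :
    shape ((var X, w) : Equation ar V) < shape ((var X, t) : Equation ar V) := by
  simp [shape, ht, hw]

/-- The equation has the sides `s` and `w`, where the variable `N` occurs in `w` only, and there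
only once, as a summand. -/
def HasLoneVar (e : Equation ar V) (s : Term ar V) (N : V) : Prop :=
  ∃ w t', (e = (s, w) ∨ e = (w, s)) ∧
    (w.summands : Multiset (Term ar V)) = t' + {var N} ∧ N ∉ s.vars ∧ ∀ v ∈ t', N ∉ v.vars

/-- `e'` is `X = t' ∪ N`, obtained from `e`, which is `X = t' ∪ X ∪ ⋯ ∪ X`. -/
def Absorbs (e e' : Equation ar V) (N : V) : Prop :=
  e'.1 = e.1 ∧ e'.HasLoneVar e'.1 N ∧ ∀ v ∈ e'.2.summands, v = var N ∨ v ∈ e.2.summands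

end Equation

/-- The selected equation `e` is replaced with the equations `new`, and the substitution `σ` is
applied to the other equations. -/
structure Advance (used : Set V) (e : Equation ar V) (σ : V → Term ar V) (new : System ar V)
    (used' : Set V) : Prop where
  subset : used ⊆ used'
  subst_eq_var : ∀ Y ∉ e.vars, σ Y = var Y
  vars_subst : ∀ Y, ∀ z ∈ (σ Y).vars, z = Y ∨ z ∈ e.vars ∨ z ∈ used' \ used
  vars_new : ∀ e' ∈ new, ∀ z ∈ Equation.vars e', z ∈ e.vars ∨ z ∈ used' \ used
  apps_subst : ∀ Y, (σ Y).apps ⊆ Term.subst σ '' e.apps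
  apps_new : ∀ e' ∈ new, Equation.apps e' ⊆ Term.subst σ '' e.apps
  progress :
    (∀ e' ∈ new, ∃ a b : Term ar V, e' = (a.subst σ, b.subst σ) ∧
      (a.StrictlyDominated e.1 ∨ a.StrictlyDominated e.2) ∧
      (b.StrictlyDominated e.1 ∨ b.StrictlyDominated e.2) ∧
      a.apps ⊆ e.apps ∧ b.apps ⊆ e.apps) ∨
    (σ = var ∧ ∃ e' : Equation ar V, new = {e'} ∧ e'.shape < e.shape ∧
      (e' = e.swap ∨ ∃ N, N ∉ used ∧ e.Absorbs e' N))
  -- The selected equation either bounds the value of its lone variable by the other side or is only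
  -- rearranged and keeps that variable lone.
  lone : ∀ s N, e.HasLoneVar s N → N ∈ used →
    (σ N).Dominated (s.subst σ) ∨ (σ = var ∧ ∃ e' : Equation ar V, new = {e'} ∧ e'.HasLoneVar s N)

namespace Advance

open Equation

theorem subset_image_subst_var (S : Set (Term ar V)) : S ⊆ Term.subst var '' S :=
  fun t ht => ⟨t, ht, t.subst_var⟩

theorem of_trivial {used : Set V} (X : V) :
    Advance used ((var X, var X) : Equation ar V) var 0 used where
  subset := le_rfl
  subst_eq_var _ _ := rfl
  vars_subst _ _ hz := Or.inl hz
  vars_new := by simp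
  apps_subst _ _ hz := hz.elim
  apps_new := by simp
  progress := Or.inl (by simp)
  lone := by
    rintro s N ⟨w, t', h, hw, hs, -⟩ -
    have : s = w := by
      rcases h with h | h <;> rw [Prod.mk.injEq] at h <;> rw [← h.1, ← h.2]
    subst this
    exact absurd (mem_vars_of_var_mem_summands (Multiset.mem_coe.1 (hw ▸ by simp))) hs

theorem of_orient {used : Set V} (t : Term ar V) (X : V) (ht : t.head ≠ none) :
    Advance used ((t, var X) : Equation ar V) var {(var X, t)} used where
  subset := le_rfl
  subst_eq_var _ _ := rfl
  vars_subst _ _ hz := Or.inl hz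
  vars_new := by
    intro e' he' z hz
    rw [Multiset.mem_singleton.1 he'] at hz
    exact Or.inl hz.symm
  apps_subst _ _ hz := hz.elim
  apps_new := by
    intro e' he' z hz
    rw [Multiset.mem_singleton.1 he'] at hz
    exact subset_image_subst_var _ hz.symm
  progress := Or.inr ⟨rfl, _, rfl, shape_orient ht, Or.inl rfl⟩
  lone := by
    rintro s N ⟨w, t', h, hw⟩ -
    refine Or.inr ⟨rfl, _, rfl, w, t', ?_, hw⟩
    rcases h with h | h <;> rw [Prod.mk.injEq] at h
    · exact Or.inr (by rw [← h.1, ← h.2])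
    · exact Or.inl (by rw [← h.1, ← h.2])

theorem of_eliminate {used : Set V} (X : V) (t : Term ar V) (hX : X ∉ t.vars) :
    Advance used ((var X, t) : Equation ar V) (single X t) 0 used where
  subset := le_rfl
  subst_eq_var Y hY := single_of_ne _ fun h => hY (Or.inl h)
  vars_subst Y z hz := by
    by_cases h : Y = X
    · rw [h, single_self] at hz
      exact Or.inr (Or.inl (Or.inr hz))
    · rw [single_of_ne _ h] at hz
      exact Or.inl hz
  vars_new := by simp
  apps_subst Y z hz := by
    by_cases h : Y = X
    · rw [h, single_self] at hz
      refine ⟨z, Or.inr hz, subst_eq_self fun y hy => single_of_ne _ ?_⟩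
      rintro rfl
      exact hX (vars_subset_of_mem_apps hz hy)
    · rw [single_of_ne _ h] at hz
      exact hz.elim
  apps_new := by simp
  progress := Or.inl (by simp)
  lone := by
    rintro s N ⟨w, t', h, hw, hs, -⟩ -
    have hN : var N ∈ w.summands := Multiset.mem_coe.1 (hw ▸ by simp)
    left
    rcases h with h | h <;> obtain ⟨rfl, rfl⟩ := Prod.ext_iff.1 h
    · rw [Term.subst, single_self, single_of_ne _ hs]
      exact dominated_of_mem_summands hN
    · obtain rfl : N = X := by simpa [summands] using hN
      rw [single_self, subst_eq_self fun y hy => single_of_ne _ ?_]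
      · exact Dominated.refl _
      · rintro rfl
        exact hX hy

theorem of_absorb {used : Set V} (X N : V) (t w : Term ar V) (t' : Multiset (Term ar V)) (k : ℕ)
    (hk : 1 ≤ k) (ht : (t.summands : Multiset (Term ar V)) = t' + Multiset.replicate k (var X))
    (ht' : ∀ s ∈ t', X ∉ s.vars) (hN : N ∉ used)
    (hw : (w.summands : Multiset (Term ar V)) = t' + {var N})
    (hused : Equation.vars ((var X, t) : Equation ar V) ⊆ used) :
    Advance used ((var X, t) : Equation ar V) var {(var X, w)} (insert N used) := by
  have mem_w : ∀ v ∈ w.summands, v = var N ∨ v ∈ t' := by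
    intro v hv
    rw [← Multiset.mem_coe, hw, Multiset.mem_add, Multiset.mem_singleton] at hv
    exact hv.symm
  have mem_t : ∀ v ∈ t', v ∈ t.summands := fun v hv => by
    rw [← Multiset.mem_coe, ht]
    exact Multiset.mem_add.2 (Or.inl hv)
  have hXt : X ∈ t.vars := by
    refine mem_vars_of_var_mem_summands ?_
    rw [← Multiset.mem_coe, ht]
    exact Multiset.mem_add.2 (Or.inr (Multiset.mem_replicate.2 ⟨by omega, rfl⟩))
  have hNX : N ≠ X := by
    rintro rfl
    exact hN (hused (Or.inl rfl))
  have hNt' : ∀ v ∈ t', N ∉ v.vars := fun v hv h =>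
    hN (hused (Or.inr (vars_subset_of_mem_summands (mem_t v hv) h)))
  refine ⟨Set.subset_insert _ _, fun _ _ => rfl, fun _ _ hz => Or.inl hz, ?_,
    fun _ _ hz => hz.elim, ?_, Or.inr ⟨rfl, _, rfl, shape_absorb hXt ?_,
      Or.inr ⟨N, hN, rfl, ⟨w, t', Or.inl rfl, hw, hNX, hNt'⟩,
        fun v hv => (mem_w v hv).imp_right (mem_t v)⟩⟩, ?_⟩
  · intro e' he' z hz
    rw [Multiset.mem_singleton.1 he'] at hz
    rcases hz with hz | hz
    · exact Or.inl (Or.inl hz)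
    · obtain ⟨v, hv, hz⟩ := mem_vars_iff_summands.1 hz
      rcases mem_w v hv with rfl | hv
      · obtain rfl : z = N := hz
        exact Or.inr ⟨Set.mem_insert _ _, hN⟩
      · exact Or.inl (Or.inr (vars_subset_of_mem_summands (mem_t v hv) hz))
  · intro e' he' z hz
    rw [Multiset.mem_singleton.1 he'] at hz
    rcases hz with hz | hz
    · exact hz.elim
    · obtain ⟨v, hv, hz⟩ := mem_apps_iff_summands.1 hz
      rcases mem_w v hv with rfl | hv
      · exact hz.elim
      · exact subset_image_subst_var _ (Or.inr (apps_subset_of_mem_summands (mem_t v hv) hz))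
  · intro h
    obtain ⟨v, hv, h⟩ := mem_vars_iff_summands.1 h
    rcases mem_w v hv with rfl | hv
    · exact hNX h.symm
    · exact ht' v hv h
  · rintro s M ⟨w₀, t₀, h, hw₀, hs, ht₀⟩ hM
    have hM₀ : var M ∈ w₀.summands := Multiset.mem_coe.1 (hw₀ ▸ by simp)
    rcases h with h | h <;> obtain ⟨rfl, rfl⟩ := Prod.ext_iff.1 h
    -- Here the lone `M` is a summand of `t` other than `X`, so it belongs to `t'` and survives in
    -- `w`.
    · right
      have hMX : M ≠ X := hs
      have hMt' : var M ∈ t' := by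
        rw [← Multiset.mem_coe, ht, Multiset.mem_add] at hM₀
        refine hM₀.resolve_right fun h => hMX ?_
        simpa using (Multiset.mem_replicate.1 h).2
      obtain ⟨t'', rfl⟩ := Multiset.exists_cons_of_mem hMt'
      refine ⟨rfl, _, rfl, w, t'' + {var N}, Or.inl rfl, ?_, hs, ?_⟩
      · rw [hw, ← Multiset.singleton_add]
        abel
      · intro v hv
        rw [Multiset.mem_add, Multiset.mem_singleton] at hv
        rcases hv with hv | rfl
        · refine ht₀ v ?_
          rw [ht, Multiset.cons_add, add_comm t₀, Multiset.singleton_add,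
            Multiset.cons_inj_right] at hw₀
          rw [← hw₀]
          exact Multiset.mem_add.2 (Or.inl hv)
        · rintro rfl
          exact hN hM
    -- If the lone variable is on the left it is `X`, but absorption applies only when `X` occurs on
    -- the right too.
    · obtain rfl : M = X := by simpa [summands] using hM₀
      exact absurd hXt hs

theorem of_decompose {used : Set V} (s t : Term ar V) (f : Sym F) (hs : s.head = some f)
    (ht : t.head = some f) (hf : f ≠ Sym.union) :
    Advance used ((s, t) : Equation ar V) var (argEqs s t) used := by
  have args : ∀ e' ∈ argEqs s t, e'.1 ∈ s.args ∧ e'.2 ∈ t.args := fun e' h =>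
    List.of_mem_zip (a := e'.1) (b := e'.2) h
  refine ⟨le_rfl, fun _ _ => rfl, fun _ _ hz => Or.inl hz, fun e' he' z hz => ?_,
    fun _ _ hz => hz.elim, fun e' he' => ?_, Or.inl fun e' he' => ?_, ?_⟩
  · exact Or.inl (hz.imp (fun h => vars_subset_of_mem_args (args e' he').1 h)
      fun h => vars_subset_of_mem_args (args e' he').2 h)
  · exact (Set.union_subset_union (apps_subset_of_mem_args (args e' he').1)
      (apps_subset_of_mem_args (args e' he').2)).trans (subset_image_subst_var _)
  · have strict : ∀ a s : Term ar V, s.head = some f → a ∈ s.args → a.StrictlyDominated s := by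
      intro a s hs ha
      cases s with
      | var x => simp [Term.args] at ha
      | empty => simp [Term.args] at ha
      | union s₁ s₂ => exact absurd (Option.some_injective _ hs).symm hf
      | app g b => exact strictlyDominated_of_mem_args ha
    exact ⟨e'.1, e'.2, by simp [subst_var], Or.inl (strict _ _ hs (args e' he').1),
      Or.inr (strict _ _ ht (args e' he').2),
      (apps_subset_of_mem_args (args e' he').1).trans Set.subset_union_left,
      (apps_subset_of_mem_args (args e' he').2).trans Set.subset_union_right⟩
  -- A side whose outermost symbol is not `∪` is its own only summand and cannot have a variable as
  -- summand.
  · rintro s₀ N ⟨w, t', h, hw, -⟩ -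
    have hN : var N ∈ w.summands := Multiset.mem_coe.1 (hw ▸ by simp)
    have hh : w.head = some f := by
      rcases h with h | h <;> obtain ⟨rfl, rfl⟩ := Prod.ext_iff.1 h <;> assumption
    cases w with
    | var x => simp [head] at hh
    | empty => simp [summands] at hN
    | union s₁ s₂ => exact absurd (Option.some_injective _ hh).symm hf
    | app g b => simp [summands] at hN

theorem of_aciStep {used : Set V} (l r : Term ar V) {E₁ E₂ : System ar V} {ρ : V → Term ar V}
    {new : Set V} (h : AciStep used l r E₁ E₂ ρ new)
    (hused : Equation.vars ((l, r) : Equation ar V) ⊆ used) :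
    Advance used ((l, r) : Equation ar V) ρ E₂ (used ∪ new) := by
  obtain ⟨G, u, E, T, -, hu, hc, hρ, hE, -, -, rfl, rfl⟩ := h
  have hnew : G.newVars ⊆ (used ∪ G.newVars) \ used := by
    rintro _ ⟨i, j, h, rfl⟩
    exact ⟨Or.inr ⟨i, j, h, rfl⟩, G.fresh i j h⟩
  have hEq : ∀ e ∈ E, ∃ p q, (p ∈ l.indivs ∨ p ∈ r.indivs) ∧ (q ∈ l.indivs ∨ q ∈ r.indivs) ∧
      e.1 ∈ p.args ∧ e.2 ∈ q.args := fun e he =>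
    G.mem_confEqs (by rw [hE]; exact Multiset.mem_add.2 (Or.inl he))
  have vars_arg : ∀ a p : Term ar V, (p ∈ l.indivs ∨ p ∈ r.indivs) → a ∈ p.args →
      a.vars ⊆ Equation.vars ((l, r) : Equation ar V) := by
    intro a p hp ha z hz
    have hz := vars_subset_of_mem_args ha hz
    exact hp.imp (fun hp => vars_subset_of_mem_summands (mem_summands_of_mem_indivs hp) hz)
      fun hp => vars_subset_of_mem_summands (mem_summands_of_mem_indivs hp) hz
  have apps_arg : ∀ a p : Term ar V, (p ∈ l.indivs ∨ p ∈ r.indivs) → a ∈ p.args →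
      a.apps ⊆ Equation.apps ((l, r) : Equation ar V) := by
    intro a p hp ha z hz
    have hz := apps_subset_of_mem_args ha hz
    exact hp.imp (fun hp => apps_subset_of_mem_summands (mem_summands_of_mem_indivs hp) hz)
      fun hp => apps_subset_of_mem_summands (mem_summands_of_mem_indivs hp) hz
  have strict : ∀ a p : Term ar V, (p ∈ l.indivs ∨ p ∈ r.indivs) → a ∈ p.args →
      a.StrictlyDominated l ∨ a.StrictlyDominated r := fun a p hp ha =>
    hp.imp (strictlyDominated_of_mem_args_indiv ha) (strictlyDominated_of_mem_args_indiv ha)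
  have vars_ρ := fun X => G.vars_removal hu hc hρ X
  have apps_ρ := fun X => G.apps_removal hu hc hρ X
  have mem_E₂ : ∀ e' ∈ System.applySubst E ρ, ∃ e ∈ E, e' = (e.1.subst ρ, e.2.subst ρ) := by
    intro e' he'
    obtain ⟨e, he, rfl⟩ := Multiset.mem_map.1 he'
    exact ⟨e, he, rfl⟩
  have vars_inst : ∀ a : Term ar V, a.vars ⊆ Equation.vars ((l, r) : Equation ar V) →
      ∀ z ∈ (a.subst ρ).vars, z ∈ Equation.vars ((l, r) : Equation ar V) ∨
        z ∈ (used ∪ G.newVars) \ used := by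
    intro a ha z hz
    obtain ⟨x, hx, hz⟩ := mem_vars_subst.1 hz
    rcases vars_ρ x z hz with rfl | h | h
    · exact Or.inl (ha hx)
    · exact Or.inl h
    · exact Or.inr (hnew h)
  have apps_inst : ∀ a : Term ar V, a.apps ⊆ Equation.apps ((l, r) : Equation ar V) →
      (a.subst ρ).apps ⊆ Term.subst ρ '' Equation.apps ((l, r) : Equation ar V) := by
    intro a ha z hz
    rcases mem_apps_subst hz with ⟨p, hp, rfl⟩ | ⟨x, -, hz⟩
    · exact ⟨p, ha hp, rfl⟩
    · exact apps_ρ x hz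
  refine ⟨Set.subset_union_left, fun Y hY => ?_, fun Y z hz => ?_, fun e' he' z hz => ?_, apps_ρ,
    fun e' he' => ?_, Or.inl fun e' he' => ?_, ?_⟩
  · exact (hρ.solved hc).1 Y fun h => hY (Guess.vars_subset_of_mem_dom h)
  · exact (vars_ρ Y z hz).imp_right fun h => h.imp_right fun h => hnew h
  · obtain ⟨e, he, rfl⟩ := mem_E₂ e' he'
    obtain ⟨p, q, hp, hq, h₁, h₂⟩ := hEq e he
    rcases hz with hz | hz
    · exact vars_inst _ (vars_arg _ p hp h₁) z hz
    · exact vars_inst _ (vars_arg _ q hq h₂) z hz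
  · obtain ⟨e, he, rfl⟩ := mem_E₂ e' he'
    obtain ⟨p, q, hp, hq, h₁, h₂⟩ := hEq e he
    exact Set.union_subset (apps_inst _ (apps_arg _ p hp h₁)) (apps_inst _ (apps_arg _ q hq h₂))
  · obtain ⟨e, he, rfl⟩ := mem_E₂ e' he'
    obtain ⟨p, q, hp, hq, h₁, h₂⟩ := hEq e he
    exact ⟨_, _, rfl, strict _ p hp h₁, strict _ q hq h₂, apps_arg _ p hp h₁, apps_arg _ q hq h₂⟩
  · rintro s N ⟨w, t', h, hw, hs, -⟩ -
    have hN : N ∈ w.topVars := mem_topVars.2 (Multiset.mem_coe.1 (hw ▸ by simp))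
    have hns : N ∉ s.topVars := fun h => hs (mem_vars_of_mem_topVars h)
    left
    rcases h with h | h <;> obtain ⟨rfl, rfl⟩ := Prod.ext_iff.1 h
    · exact (G.removal_dominated hused hu hc hρ (Guess.mem_dom.2 (Or.inr hN))).1 hns
    · exact (G.removal_dominated hused hu hc hρ (Guess.mem_dom.2 (Or.inl hN))).2 hns

end Advance

/-- Uniform view of the non-failing rules. The solved part is forgotten, since no equation is ever
selected from it. -/
theorem Iteration.exists_advance {Es Ens Es' Ens' : System ar V} {used used' : Set V}
    (h : Iteration (.run Es Ens used) (.run Es' Ens' used'))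
    (hused : System.vars Ens ⊆ used) :
    ∃ e R σ new, Ens = e ::ₘ R ∧ Ens' = System.applySubst R σ + new ∧
      Advance used e σ new used' := by
  have id : ∀ R : System ar V, System.applySubst R var = R := fun R => by
    simp [System.applySubst, subst_var]
  have he : ∀ e R, Ens = e ::ₘ R → Equation.vars e ⊆ used := fun e R h z hz =>
    hused ⟨e, h ▸ Multiset.mem_cons_self e R, hz⟩
  cases h with
  | trivial X => exact ⟨_, _, _, 0, rfl, by rw [id, add_zero], .of_trivial X⟩
  | orient t X ht =>
    exact ⟨_, _, _, _, rfl, by rw [id, add_comm, Multiset.singleton_add], .of_orient t X ht⟩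
  | eliminate X t h => exact ⟨_, _, _, 0, rfl, by rw [add_zero], .of_eliminate X t h⟩
  | absorb X N t w t' k hX hk ht ht' hN hw =>
    exact ⟨_, _, _, _, rfl, by rw [id, add_comm, Multiset.singleton_add],
      .of_absorb X N t w t' k hk ht ht' hN hw (he _ _ rfl)⟩
  | decompose s t f hs ht hf =>
    exact ⟨_, _, _, _, rfl, by rw [id], .of_decompose s t f hs ht hf⟩
  | setStep s₁ s₂ t₁ t₂ E₁ E₂ ρ new h =>
    exact ⟨_, _, _, _, rfl, rfl, .of_aciStep _ _ h (he _ _ rfl)⟩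

/-! ### Infinite computations -/

theorem Term.depth_subst_le_of_summands {t : Term ar V} {τ : V → Term ar V} {b : ℕ}
    (h : ∀ v ∈ t.summands, (v.subst τ).depth ≤ b) : (t.subst τ).depth ≤ b := by
  induction t with
  | union s t hs ht =>
    exact max_le (hs fun v hv => h v (List.mem_append_left _ hv))
      (ht fun v hv => h v (List.mem_append_right _ hv))
  | _ => exact h _ (List.mem_singleton_self _)

theorem Term.notMem_vars_subst {σ : V → Term ar V} {N : V} (h : ∀ Y ≠ N, N ∉ (σ Y).vars)
    {t : Term ar V} (ht : N ∉ t.vars) : N ∉ (t.subst σ).vars := by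
  intro hN
  obtain ⟨x, hx, hN⟩ := mem_vars_subst.1 hN
  exact h x (fun e => ht (e ▸ hx)) hN

theorem Equation.HasLoneVar.subst {e : Equation ar V} {s : Term ar V} {N : V}
    (he : e.HasLoneVar s N) {σ : V → Term ar V} (hN : σ N = var N)
    (h : ∀ Y ≠ N, N ∉ (σ Y).vars) :
    Equation.HasLoneVar (e.1.subst σ, e.2.subst σ) (s.subst σ) N := by
  obtain ⟨w, t', hsw, hw, hs, ht'⟩ := he
  refine ⟨w.subst σ, t'.bind fun v => ((v.subst σ).summands : Multiset (Term ar V)), ?_, ?_,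
    notMem_vars_subst h hs, ?_⟩
  · rcases hsw with rfl | rfl
    · exact Or.inl rfl
    · exact Or.inr rfl
  · have : ((w.subst σ).summands : Multiset (Term ar V)) =
        (w.summands : Multiset (Term ar V)).bind
          fun v => ((v.subst σ).summands : Multiset (Term ar V)) := by
      rw [summands_subst, Multiset.coe_bind]
    rw [this, hw, Multiset.add_bind, Multiset.singleton_bind]
    simp [Term.subst, hN, summands]
  · intro v hv
    obtain ⟨v', hv', hv⟩ := Multiset.mem_bind.1 hv
    exact fun hNv => notMem_vars_subst h (ht' v' hv') (vars_subset_of_mem_summands hv hNv)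

/-! ### Ranks with respect to the future substitutions -/

/-- The composition of the `d` substitutions that follow the first `n` ones. -/
def iterSubst (σ : ℕ → V → Term ar V) : ℕ → ℕ → V → Term ar V
  | _, 0 => var
  | n, d + 1 => comp (σ n) (iterSubst σ (n + 1) d)

/-- The largest depth of the future instances of a term. -/
noncomputable def rank (σ : ℕ → V → Term ar V) (n : ℕ) (t : Term ar V) : ℕ :=
  ⨆ d, (t.subst (iterSubst σ n d)).depth

/-- The depths of the future instances of a term are bounded. -/
def HasRank (σ : ℕ → V → Term ar V) (n : ℕ) (t : Term ar V) : Prop :=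
  BddAbove (Set.range fun d => (t.subst (iterSubst σ n d)).depth)

section rank

variable {σ : ℕ → V → Term ar V} {n : ℕ}

theorem subst_iterSubst_succ (t : Term ar V) (d : ℕ) :
    t.subst (iterSubst σ n (d + 1)) = (t.subst (σ n)).subst (iterSubst σ (n + 1) d) :=
  subst_comp _ _ _

theorem HasRank.depth_le {t : Term ar V} (h : HasRank σ n t) (d : ℕ) :
    (t.subst (iterSubst σ n d)).depth ≤ rank σ n t :=
  le_ciSup h d

theorem rank_le {t : Term ar V} {b : ℕ} (h : ∀ d, (t.subst (iterSubst σ n d)).depth ≤ b) :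
    rank σ n t ≤ b :=
  ciSup_le h

theorem rank_lt {s t : Term ar V} (h : s.StrictlyDominated t) (ht : HasRank σ n t) :
    rank σ n s < rank σ n t := by
  have h₁ : ∀ d, (s.subst (iterSubst σ n d)).depth < rank σ n t := fun d =>
    (h _).trans_le (ht.depth_le d)
  have h₂ : rank σ n s ≤ rank σ n t - 1 := rank_le fun d => Nat.le_sub_one_of_lt (h₁ d)
  -- This makes the rank of `t` positive, so the subtraction of `1` does not truncate.
  have := h₁ 0
  omega

/-- The two suprema range over the same depths except that of `t` itself, which can be omitted since
a substitution never decreases the depth. -/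
theorem rank_succ {t : Term ar V} (ht : HasRank σ n t) :
    rank σ (n + 1) (t.subst (σ n)) = rank σ n t := by
  have hb : HasRank σ (n + 1) (t.subst (σ n)) := by
    refine ⟨rank σ n t, ?_⟩
    rintro _ ⟨d, rfl⟩
    simpa only [subst_iterSubst_succ] using ht.depth_le (d + 1)
  refine le_antisymm (rank_le fun d => ?_) (rank_le fun d => ?_)
  · rw [← subst_iterSubst_succ]
    exact ht.depth_le (d + 1)
  · cases d with
    | zero =>
      rw [iterSubst, subst_var]
      refine (depth_le_depth_subst t (σ n)).trans ?_
      simpa only [iterSubst, subst_var] using hb.depth_le 0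
    | succ d =>
      rw [subst_iterSubst_succ]
      exact hb.depth_le d

end rank

/-! ### The decreasing measure of an infinite computation -/

/-- An infinite computation: `e n` is the equation that is selected in `Ens n`, and `R n` consists
of the other equations. -/
structure Run (Ens : ℕ → System ar V) (used : ℕ → Set V) (e : ℕ → Equation ar V)
    (R : ℕ → System ar V) (σ : ℕ → V → Term ar V) (new : ℕ → System ar V) : Prop where
  split : ∀ n, Ens n = e n ::ₘ R n
  next : ∀ n, Ens (n + 1) = System.applySubst (R n) (σ n) + new n
  advance : ∀ n, Advance (used n) (e n) (σ n) (new n) (used (n + 1))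
  vars_subset : ∀ n, System.vars (Ens n) ⊆ used n

theorem System.applySubst_var (E : System ar V) : System.applySubst E var = E := by
  simp [System.applySubst, subst_var]

/-- The terms with a free outermost symbol of the initial system, under the first `n`
substitutions. -/
def tracked (T : Set (Term ar V)) (σ : ℕ → V → Term ar V) : ℕ → Set (Term ar V)
  | 0 => T
  | n + 1 => Term.subst (σ n) '' tracked T σ n

theorem Advance.vars_next {Ens R new : System ar V} {used used' : Set V} {e : Equation ar V}
    {σ : V → Term ar V} (h : Advance used e σ new used') (hE : Ens = e ::ₘ R)
    (hused : System.vars Ens ⊆ used) :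
    System.vars (System.applySubst R σ + new) ⊆ used' := by
  have he : e.vars ⊆ used := fun z hz => hused ⟨e, hE ▸ Multiset.mem_cons_self _ _, hz⟩
  have hσ : ∀ t : Term ar V, t.vars ⊆ used → (t.subst σ).vars ⊆ used' := by
    intro t ht z hz
    obtain ⟨x, hx, hz⟩ := mem_vars_subst.1 hz
    rcases h.vars_subst x z hz with rfl | h' | h'
    · exact h.subset (ht hx)
    · exact h.subset (he h')
    · exact h'.1
  rintro z ⟨e', he', hz⟩
  rcases Multiset.mem_add.1 he' with he' | he'
  · obtain ⟨e₀, he₀, rfl⟩ := Multiset.mem_map.1 he'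
    have h₀ : e₀.vars ⊆ used := fun z hz =>
      hused ⟨e₀, hE ▸ Multiset.mem_cons_of_mem he₀, hz⟩
    exact hz.elim (fun hz => hσ _ (fun x hx => h₀ (Or.inl hx)) hz)
      fun hz => hσ _ (fun x hx => h₀ (Or.inr hx)) hz
  · exact (h.vars_new e' he' z hz).elim (fun h' => h.subset (he h')) fun h' => h'.1

namespace Run

variable {Ens : ℕ → System ar V} {used : ℕ → Set V} {e : ℕ → Equation ar V}
  {R : ℕ → System ar V} {σ : ℕ → V → Term ar V} {new : ℕ → System ar V}

theorem selected_mem (h : Run Ens used e R σ new) (n : ℕ) : e n ∈ Ens n := by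
  rw [h.split]
  exact Multiset.mem_cons_self _ _

theorem apps_subset_tracked (h : Run Ens used e R σ new) (n : ℕ) :
    ∀ e' ∈ Ens n, Equation.apps e' ⊆ tracked {t | ∃ e' ∈ Ens 0, t ∈ Equation.apps e'} σ n := by
  induction n with
  | zero => exact fun e' he' t ht => ⟨e', he', ht⟩
  | succ n ih =>
    intro e' he'
    have hsel := ih _ (h.selected_mem n)
    rw [h.next, Multiset.mem_add] at he'
    rcases he' with he' | he'
    · obtain ⟨e₀, he₀, rfl⟩ := Multiset.mem_map.1 he'
      have ih₀ := ih e₀ (by rw [h.split]; exact Multiset.mem_cons_of_mem he₀)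
      have key : ∀ t : Term ar V, t.apps ⊆ Equation.apps e₀ → (t.subst (σ n)).apps ⊆
          tracked {t | ∃ e' ∈ Ens 0, t ∈ Equation.apps e'} σ (n + 1) := by
        intro t ht z hz
        rcases mem_apps_subst hz with ⟨p, hp, rfl⟩ | ⟨x, -, hz⟩
        · exact ⟨p, ih₀ (ht hp), rfl⟩
        · exact Set.image_mono hsel ((h.advance n).apps_subst x hz)
      exact Set.union_subset (key _ Set.subset_union_left) (key _ Set.subset_union_right)
    · exact ((h.advance n).apps_new e' he').trans (Set.image_mono hsel)

theorem apps_subst_iterSubst (h : Run Ens used e R σ new) (d : ℕ) : ∀ (n : ℕ) (t : Term ar V),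
    t.apps ⊆ tracked {t | ∃ e' ∈ Ens 0, t ∈ Equation.apps e'} σ n →
    (t.subst (iterSubst σ n d)).apps ⊆
      tracked {t | ∃ e' ∈ Ens 0, t ∈ Equation.apps e'} σ (n + d) := by
  induction d with
  | zero =>
    intro n t ht
    rwa [iterSubst, subst_var]
  | succ d ih =>
    intro n t ht
    rw [subst_iterSubst_succ, add_comm d 1, ← add_assoc]
    refine ih (n + 1) _ fun z hz => ?_
    rcases mem_apps_subst hz with ⟨p, hp, rfl⟩ | ⟨x, -, hz⟩
    · exact ⟨p, ht hp, rfl⟩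
    · exact Set.image_mono (h.apps_subset_tracked n _ (h.selected_mem n))
        ((h.advance n).apps_subst x hz)

/-- Passing to images never increases a cardinality, so the number of initial free subterms bounds
the depth of every future instance. The hypothesis on `t.apps` also admits arguments of the sides,
for the equations that replace `e'`. -/
theorem hasRank (h : Run Ens used e R σ new) {n : ℕ} {e' : Equation ar V} (he' : e' ∈ Ens n)
    {t : Term ar V} (ht : t.apps ⊆ e'.apps) : HasRank σ n t := by
  have hfin : ∀ m, (tracked {t | ∃ e' ∈ Ens 0, t ∈ Equation.apps e'} σ m).Finite ∧
      (tracked {t | ∃ e' ∈ Ens 0, t ∈ Equation.apps e'} σ m).ncard ≤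
        {t | ∃ e' ∈ Ens 0, t ∈ Equation.apps e'}.ncard := by
    intro m
    induction m with
    | zero =>
      refine ⟨?_, le_rfl⟩
      have : {t | ∃ e' ∈ Ens 0, t ∈ Equation.apps e'} =
          ⋃ e' ∈ {e' | e' ∈ Ens 0}, Equation.apps e' := by
        ext t
        simp
      rw [tracked, this]
      refine Set.Finite.biUnion ?_ fun e' _ => (finite_apps _).union (finite_apps _)
      exact Multiset.finite_toSet (Ens 0)
    | succ m ih => exact ⟨ih.1.image _, (Set.ncard_image_le ih.1).trans ih.2⟩
  refine ⟨{t | ∃ e' ∈ Ens 0, t ∈ Equation.apps e'}.ncard, ?_⟩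
  rintro _ ⟨d, rfl⟩
  refine (depth_le_ncard_apps _).trans (le_trans ?_ (hfin (n + d)).2)
  exact Set.ncard_le_ncard
    (h.apps_subst_iterSubst d n t (ht.trans (h.apps_subset_tracked n e' he'))) (hfin _).1

/-- The property "`N` is lone in one equation and absent from all others" is followed along the run.
Before that equation is selected, `N` is neither instantiated nor copied elsewhere; when it is
selected, `Advance.lone` either keeps the property or bounds `N` by the side `s`. -/
theorem depth_loneVar_le (h : Run Ens used e R σ new) (b d : ℕ) :
    ∀ (n : ℕ) (e' : Equation ar V) (R' : System ar V) (s : Term ar V) (N : V),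
      Ens n = e' ::ₘ R' → e'.HasLoneVar s N → (∀ e'' ∈ R', N ∉ Equation.vars e'') →
      (∀ d, (s.subst (iterSubst σ n d)).depth ≤ b) → (iterSubst σ n d N).depth ≤ b := by
  induction d with
  | zero => exact fun _ _ _ _ _ _ _ _ _ => Nat.zero_le _
  | succ d ih =>
    intro n e' R' s N hE hN hR' hs
    have hNused : N ∈ used n := by
      obtain ⟨w, t', hsw, hw, -⟩ := hN
      have hNw : N ∈ w.vars :=
        mem_vars_of_var_mem_summands (Multiset.mem_coe.1 (hw ▸ by simp))
      refine h.vars_subset n ⟨e', hE ▸ Multiset.mem_cons_self _ _, ?_⟩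
      rcases hsw with rfl | rfl
      · exact Or.inr hNw
      · exact Or.inl hNw
    have hs' : ∀ d, ((s.subst (σ n)).subst (iterSubst σ (n + 1) d)).depth ≤ b := fun d => by
      rw [← subst_iterSubst_succ]
      exact hs (d + 1)
    change ((σ n N).subst (iterSubst σ (n + 1) d)).depth ≤ b
    have hadv := h.advance n
    -- The selected equation either is the one that contains `N` or is one of the others.
    rcases Multiset.cons_eq_cons.1 ((h.split n).symm.trans hE) with ⟨rfl, hR⟩ | ⟨-, cs, hR, rfl⟩
    · rcases hadv.lone s N hN hNused with hdom | ⟨hσ, e'', hnew, hN'⟩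
      · exact (hdom _).trans (hs' d)
      · rw [hσ]
        refine ih (n + 1) e'' R' s N ?_ hN' hR' fun d => ?_
        · rw [h.next, hσ, hnew, hR, System.applySubst_var, add_comm, Multiset.singleton_add]
        · have := hs' d
          rwa [hσ, subst_var] at this
    · have hNe : N ∉ (e n).vars := hR' _ (Multiset.mem_cons_self _ _)
      have hσN : σ n N = var N := hadv.subst_eq_var N hNe
      have hσ : ∀ Y ≠ N, N ∉ (σ n Y).vars := by
        intro Y hY hmem
        rcases hadv.vars_subst Y N hmem with h' | h' | h'
        · exact hY h'.symm
        · exact hNe h'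
        · exact h'.2 hNused
      rw [hσN]
      refine ih (n + 1) (e'.1.subst (σ n), e'.2.subst (σ n))
        (System.applySubst cs (σ n) + new n) (s.subst (σ n)) N ?_ (hN.subst hσN hσ) ?_ hs'
      · rw [h.next, hR, System.applySubst, Multiset.map_cons, Multiset.cons_add]
        rfl
      · intro e'' he''
        rcases Multiset.mem_add.1 he'' with he'' | he''
        · obtain ⟨e₀, he₀, rfl⟩ := Multiset.mem_map.1 he''
          have := hR' e₀ (Multiset.mem_cons_of_mem he₀)
          exact not_or.2 ⟨notMem_vars_subst hσ fun hm => this (Or.inl hm),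
            notMem_vars_subst hσ fun hm => this (Or.inr hm)⟩
        · exact fun hm => (hadv.vars_new e'' he'' N hm).elim hNe fun h' => h'.2 hNused

/-- The rank of an equation. -/
noncomputable def eqRank (σ : ℕ → V → Term ar V) (n : ℕ) (e : Equation ar V) : ℕ :=
  max (rank σ n e.1) (rank σ n e.2)

/-- After absorption, the summands from `t'` were already in the old right-hand side, and the future
of `N` is bounded through the other side, the unchanged `X`. -/
theorem eqRank_rearranged_le (h : Run Ens used e R σ new) {n : ℕ} {e' : Equation ar V}
    (hσ : σ n = var) (hnew : new n = {e'})
    (he' : e' = (e n).swap ∨ ∃ N, N ∉ used n ∧ (e n).Absorbs e' N) :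
    eqRank σ (n + 1) e' ≤ eqRank σ n (e n) := by
  have hr₁ : HasRank σ n (e n).1 := h.hasRank (h.selected_mem n) Set.subset_union_left
  have hr₂ : HasRank σ n (e n).2 := h.hasRank (h.selected_mem n) Set.subset_union_right
  have hvar : ∀ (t : Term ar V) (d), t.subst (iterSubst σ (n + 1) d) = t.subst (iterSubst σ n (d + 1)) := by
    intro t d
    rw [subst_iterSubst_succ, hσ, subst_var]
  have hsucc : ∀ t, HasRank σ n t → rank σ (n + 1) t = rank σ n t := by
    intro t ht
    have := rank_succ ht
    rwa [hσ, subst_var] at this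
  rcases he' with rfl | ⟨N, hN, h₁, hlone, h₂⟩
  · rw [eqRank, eqRank, Prod.fst_swap, Prod.snd_swap, hsucc _ hr₁, hsucc _ hr₂, max_comm]
  · rw [eqRank, eqRank, h₁, hsucc _ hr₁]
    refine max_le (le_max_left _ _) (rank_le fun d => depth_subst_le_of_summands fun v hv => ?_)
    rcases h₂ v hv with rfl | hv
    · refine h.depth_loneVar_le _ d (n + 1) e' (R n) _ N ?_ hlone (fun e'' he'' hm => ?_)
        fun d => ?_
      · rw [h.next, hσ, hnew, System.applySubst_var, add_comm, Multiset.singleton_add]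
      · refine hN (h.vars_subset n ⟨e'', ?_, hm⟩)
        rw [h.split]
        exact Multiset.mem_cons_of_mem he''
      · rw [h₁, hvar]
        exact (hr₁.depth_le _).trans (le_max_left _ _)
    · rw [hvar]
      exact (dominated_of_mem_summands hv _).trans ((hr₂.depth_le _).trans (le_max_right _ _))

theorem eqRank_new_lt (h : Run Ens used e R σ new) {n : ℕ} {a : Term ar V}
    (ha : a.StrictlyDominated (e n).1 ∨ a.StrictlyDominated (e n).2)
    (happs : a.apps ⊆ (e n).apps) :
    rank σ (n + 1) (a.subst (σ n)) < eqRank σ n (e n) := by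
  rw [rank_succ (h.hasRank (h.selected_mem n) happs)]
  rcases ha with ha | ha
  · exact (rank_lt ha (h.hasRank (h.selected_mem n) Set.subset_union_left)).trans_le
      (le_max_left _ _)
  · exact (rank_lt ha (h.hasRank (h.selected_mem n) Set.subset_union_right)).trans_le
      (le_max_right _ _)

/-- A nontrivial substitution can raise the shapes of the other equations, but it occurs only in
steps that decrease the multiset of ranks. When the ranks tie, `σ n` is the identity and only the
shape of the selected equation changes. -/
theorem measure_decreases (h : Run Ens used e R σ new) (n : ℕ) :
    Multiset.IsDershowitzMannaLT ((Ens (n + 1)).map (eqRank σ (n + 1)))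
      ((Ens n).map (eqRank σ n)) ∨
    (Ens (n + 1)).map (eqRank σ (n + 1)) = (Ens n).map (eqRank σ n) ∧
      ((Ens (n + 1)).map Equation.shape).sum < ((Ens n).map Equation.shape).sum := by
  have hR : (System.applySubst (R n) (σ n)).map (eqRank σ (n + 1)) = (R n).map (eqRank σ n) := by
    rw [System.applySubst, Multiset.map_map]
    refine Multiset.map_congr rfl fun e₀ he₀ => ?_
    have hmem : e₀ ∈ Ens n := by
      rw [h.split]
      exact Multiset.mem_cons_of_mem he₀
    simp only [Function.comp, eqRank]
    rw [rank_succ (h.hasRank hmem Set.subset_union_left),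
      rank_succ (h.hasRank hmem Set.subset_union_right)]
  have hM : (Ens n).map (eqRank σ n) = (R n).map (eqRank σ n) + {eqRank σ n (e n)} := by
    rw [h.split, Multiset.map_cons, add_comm, Multiset.singleton_add]
  have hM' : (Ens (n + 1)).map (eqRank σ (n + 1)) =
      (R n).map (eqRank σ n) + (new n).map (eqRank σ (n + 1)) := by
    rw [h.next, Multiset.map_add, hR]
  have lt_of : (∀ e' ∈ new n, eqRank σ (n + 1) e' < eqRank σ n (e n)) →
      Multiset.IsDershowitzMannaLT ((Ens (n + 1)).map (eqRank σ (n + 1)))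
        ((Ens n).map (eqRank σ n)) := by
    refine fun hlt => ⟨_, _, _, Multiset.singleton_ne_zero _, hM', hM, fun y hy => ?_⟩
    obtain ⟨e', he', rfl⟩ := Multiset.mem_map.1 hy
    exact ⟨_, Multiset.mem_singleton_self _, hlt e' he'⟩
  rcases (h.advance n).progress with hprog | ⟨hσ, e', hnew, hshape, he'⟩
  · refine Or.inl (lt_of fun e' he' => ?_)
    obtain ⟨a, b, rfl, ha, hb, ha', hb'⟩ := hprog e' he'
    exact max_lt (h.eqRank_new_lt ha ha') (h.eqRank_new_lt hb hb')
  · rcases (h.eqRank_rearranged_le hσ hnew he').lt_or_eq with hlt | heq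
    · refine Or.inl (lt_of fun e'' he'' => ?_)
      rw [hnew, Multiset.mem_singleton] at he''
      exact he'' ▸ hlt
    · refine Or.inr ⟨by rw [hM, hM', hnew, Multiset.map_singleton, heq], ?_⟩
      rw [h.next, h.split, hnew, hσ, System.applySubst_var, Multiset.map_add, Multiset.map_cons,
        Multiset.sum_add, Multiset.sum_cons, Multiset.map_singleton, Multiset.sum_singleton,
        add_comm]
      exact Nat.add_lt_add_right hshape _

theorem false (h : Run Ens used e R σ new) : False := by
  have wf : WellFounded (Prod.Lex (Multiset.IsDershowitzMannaLT (α := ℕ)) (· < · : ℕ → ℕ → Prop)) :=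
    WellFounded.prod_lex Multiset.wellFounded_isDershowitzMannaLT wellFounded_lt
  refine (wellFounded_iff_isEmpty_descending_chain.1 wf).false
    ⟨fun n => ((Ens n).map (eqRank σ n), ((Ens n).map Equation.shape).sum), fun n => ?_⟩
  rcases h.measure_decreases n with hlt | ⟨heq, hlt⟩
  · exact Prod.Lex.left _ _ hlt
  · dsimp only
    rw [heq]
    exact Prod.Lex.right _ hlt

end Run

end GeneralACI

theorem mainTheorem2 {F : Type*} (ar : F → ℕ) {V : Type*} [Countable V] [Infinite V]
    (E : GeneralACI.System ar V) :
    ¬ ∃ c : ℕ → GeneralACI.Config ar V, c 0 = GeneralACI.Config.init E ∧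
      ∀ n, GeneralACI.Iteration (c n) (c (n + 1)) := by
  rintro ⟨c, hc₀, hc⟩
  have hrun : ∀ n, ∃ Es Ens used, c n = .run Es Ens used := by
    intro n
    have := hc n
    cases hcn : c n with
    | run Es Ens used => exact ⟨_, _, _, rfl⟩
    | fail =>
      rw [hcn] at this
      -- No iteration starts from `fail`, so an infinite sequence never reaches it.
      cases this
  choose Es Ens used hEq using hrun
  have hstep : ∀ n, GeneralACI.Iteration (.run (Es n) (Ens n) (used n))
      (.run (Es (n + 1)) (Ens (n + 1)) (used (n + 1))) := fun n => by
    rw [← hEq, ← hEq]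
    exact hc n
  have hused : ∀ n, GeneralACI.System.vars (Ens n) ⊆ used n := by
    intro n
    induction n with
    | zero =>
      have := (hEq 0).symm.trans hc₀
      rw [GeneralACI.Config.init, GeneralACI.Config.run.injEq] at this
      rw [this.2.1, this.2.2]
    | succ n ih =>
      obtain ⟨e, R, σ, new, h₁, h₂, hadv⟩ := (hstep n).exists_advance ih
      rw [h₂]
      exact hadv.vars_next h₁ ih
  choose e R σ new h₁ h₂ h₃ using fun n => (hstep n).exists_advance (hused n)
  exact GeneralACI.Run.false ⟨h₁, h₂, h₃, hused⟩
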